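/- Definitions, all made in the language of second-order arithmetic. We use the pairing map $(m,n)=(m+n)^2+m$; finite sets and finite sequences are coded by natural numbers in the usual way. A sequence of sets $\mathcal A=\langle A_i:i\in\mathbb N\rangle$ is coded by one set, with $v\in A_i$ iff $(i,v)\in\mathcal A$. A *countable algebra* over $V\subseteq\mathbb N$ is a sequence $\mathcal A=\langle A_i:i\in\mathbb N\rangle$ of subsets of $V$ that contains $V$ and is closed under unions, intersections and complements $A_i^c=V\setminus A_i$; it is *atomic* if for each $v\in V$ some $A_k=\{v\}$. A set $\mathcal U\subseteq\mathbb N$ is an *ultrafilter* on $\mathcal A$ if for all $i,j,k$: $A_i=V$ implies $i\in\mathcal U$; $A_i=\emptyset$ implies $i\notin\mathcal U$; $i\in\mathcal U$ and $A_i\subseteq A_j$ imply $j\in\mathcal U$; $i,j\in\mathcal U$ and $A_k=A_i\cap A_j$ imply $k\in\mathcal U$; and $A_j=A_i^c$ implies $i\in\mathcal U$ or $j\in\mathcal U$. It is *principal* if there are $k,d$ with $k\in\mathcal U$ and $A_k=\{d\}$, and *non-principal* otherwise. A *countable society* $\mathcal S=\langle V,X,\mathcal A,\mathcal F\rangle$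 consists of a nonempty set $V\subseteq\mathbb N$ (voters), a finite set $X\subseteq\mathbb N$ (alternatives) with $|X|\ge 3$, an atomic countable algebra $\mathcal A$ over $V$, and a sequence $\mathcal F=\langle f_i:i\in\mathbb N\rangle$ of functions $f_i:V\to W$ (profiles), where $W$ is the finite set of codes of weak orders (transitive, strongly connected relations) on $X$, such that conditions 1 and 2 below hold. Write $x\lesssim_{i(v)}y$ if $(x,y)\in f_i(v)$, and $x<_{i(v)}y$ if moreover $(y,x)\notin f_i(v)$; similarly $x\lesssim_{\sigma(i)}y$ and $x<_{\sigma(i)}y$ for a function $\sigma:\mathbb N\to W$. 1. *Uniform measurability*: there is $\mu:\mathbb N\times X\times X\to\mathbb N$ with $x\lesssim_{n(v)}y\leftrightarrow v\in A_{\mu(n,x,y)}$ for all $n\in\mathbb N$, $x,y\in X$, $v\in V$. 2. *Quasi-partition embedding*: there is a function $e$, assigning a number to each pair of a permutation $p$ of $W$ (a finite sequence of elements of $W$ in which each element of $W$ occurs exactly once) and a finite sequence $s$ of numbers with length $1\le\mathrm{lh}(s)\le|W|$, such that for all $v\in V$: $f_{e(p,s)}(v)=p(i)$ if $i$ is the unique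 $i<\mathrm{lh}(s)-1$ with $v\in A_{s(i)}$, and $f_{e(p,s)}(v)=p(\mathrm{lh}(s)-1)$ if there is no such unique $i$. A *social welfare function* for $\mathcal S$ is a function $\sigma:\mathbb N\to W$ such that for all $x,y\in X$ and $i,j\in\mathbb N$: if $x<_{i(v)}y$ for all $v\in V$ then $x<_{\sigma(i)}y$ (unanimity); and if for every $v\in V$ the orders $f_i(v)$ and $f_j(v)$ agree on $\{x,y\}$, then $\sigma(i)$ and $\sigma(j)$ agree on $\{x,y\}$ (independence). The coalition $A_n$ is *$\sigma$-decisive* if for all $x,y\in X$ and all $i$: if $x<_{i(v)}y$ for all $v\in A_n$ then $x<_{\sigma(i)}y$. And $\sigma$ has the *cofinite coalitions property* if for all $j\in\mathbb N$ and $x,y\in X$: if $x<_{j(v)}y$ for cofinitely many $v\in V$ (all $v\in V$ from some number on), then $x<_{\sigma(j)}y$. **Lemma.** The following statement is provable in $\mathsf{RCA}_0$ (the axioms of commutative discrete ordered semirings, $\Sigma^0_1$ induction and $\Delta^0_1$ comprehension); that is, it holds in every model of $\mathsf{RCA}_0$, including those with nonstandard natural numbers. Suppose $\mathcal S=\langle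 V,X,\mathcal A,\mathcal F\rangle$ is a countable society. If $\mathcal U$ is an ultrafilter on $\mathcal A$, then there exists a social welfare function $\sigma_{\mathcal U}$ for $\mathcal S$ such that 1. for all $i\in\mathbb N$, $i\in\mathcal U$ if and only if $A_i$ is $\sigma_{\mathcal U}$-decisive; and 2. $\mathcal U$ is non-principal if and only if $\sigma_{\mathcal U}$ has the cofinite coalitions property. -/

import Mathlib

universe u

namespace L2

/-! ### The two-sorted language of second-order arithmetic

Number variables and set variables are both named by natural numbers (two separate stocks of
names). -/

/-- Number terms. -/
inductive Term : Type
  | var (x : ℕ) : Term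
  | zero : Term
  | one : Term
  | add (s t : Term) : Term
  | mul (s t : Term) : Term

instance : Zero Term := ⟨Term.zero⟩
instance : One Term := ⟨Term.one⟩
instance : Add Term := ⟨Term.add⟩
instance : Mul Term := ⟨Term.mul⟩

/-- Formulas: `all₁`, `ex₁` bind number variables, `all₂`, `ex₂` bind set variables. -/
inductive Formula : Type
  | eq (s t : Term) : Formula
  | lt (s t : Term) : Formula
  | mem (t : Term) (X : ℕ) : Formula
  | neg (φ : Formula) : Formula
  | and (φ ψ : Formula) : Formula
  | or (φ ψ : Formula) : Formula
  | imp (φ ψ : Formula) : Formula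
  | iff (φ ψ : Formula) : Formula
  | all₁ (x : ℕ) (φ : Formula) : Formula
  | ex₁ (x : ℕ) (φ : Formula) : Formula
  | all₂ (X : ℕ) (φ : Formula) : Formula
  | ex₂ (X : ℕ) (φ : Formula) : Formula

/-- The variables of a term. -/
def Term.vars : Term → Set ℕ
  | .var x => {x}
  | .zero => ∅
  | .one => ∅
  | .add s t => s.vars ∪ t.vars
  | .mul s t => s.vars ∪ t.vars

/-- The free number variables of a formula. -/
def Formula.freeNum : Formula → Set ℕ
  | .eq s t => s.vars ∪ t.vars
  | .lt s t => s.vars ∪ t.vars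
  | .mem t _ => t.vars
  | .neg φ => φ.freeNum
  | .and φ ψ => φ.freeNum ∪ ψ.freeNum
  | .or φ ψ => φ.freeNum ∪ ψ.freeNum
  | .imp φ ψ => φ.freeNum ∪ ψ.freeNum
  | .iff φ ψ => φ.freeNum ∪ ψ.freeNum
  | .all₁ x φ => φ.freeNum \ {x}
  | .ex₁ x φ => φ.freeNum \ {x}
  | .all₂ _ φ => φ.freeNum
  | .ex₂ _ φ => φ.freeNum

/-- The free set variables of a formula. -/
def Formula.freeSet : Formula → Set ℕ
  | .eq _ _ => ∅
  | .lt _ _ => ∅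
  | .mem _ X => {X}
  | .neg φ => φ.freeSet
  | .and φ ψ => φ.freeSet ∪ ψ.freeSet
  | .or φ ψ => φ.freeSet ∪ ψ.freeSet
  | .imp φ ψ => φ.freeSet ∪ ψ.freeSet
  | .iff φ ψ => φ.freeSet ∪ ψ.freeSet
  | .all₁ _ φ => φ.freeSet
  | .ex₁ _ φ => φ.freeSet
  | .all₂ X φ => φ.freeSet \ {X}
  | .ex₂ X φ => φ.freeSet \ {X}

/-! ### Structures and satisfaction -/

/-- A structure for the language: an arbitrary (possibly nonstandard) first-order part, and a
nonempty collection of subsets of it over which the set variables range. -/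
structure Model : Type (u + 1) where
  carrier : Type u
  zero : carrier
  one : carrier
  add : carrier → carrier → carrier
  mul : carrier → carrier → carrier
  lt : carrier → carrier → Prop
  sets : Set (Set carrier)
  sets_nonempty : sets.Nonempty

/-- The value of a term under an assignment. -/
def Term.val (M : Model.{u}) (e : ℕ → M.carrier) : Term → M.carrier
  | .var x => e x
  | .zero => M.zero
  | .one => M.one
  | .add s t => M.add (s.val M e) (t.val M e)
  | .mul s t => M.mul (s.val M e) (t.val M e)

/-- Satisfaction of a formula under assignments `e` of the number variables and `E` of the set
variables. -/
def Formula.Realize (M : Model.{u}) : Formula → (ℕ → M.carrier) → (ℕ → M.sets) → Prop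
  | .eq s t, e, _ => s.val M e = t.val M e
  | .lt s t, e, _ => M.lt (s.val M e) (t.val M e)
  | .mem t X, e, E => t.val M e ∈ (E X : Set M.carrier)
  | .neg φ, e, E => ¬ φ.Realize M e E
  | .and φ ψ, e, E => φ.Realize M e E ∧ ψ.Realize M e E
  | .or φ ψ, e, E => φ.Realize M e E ∨ ψ.Realize M e E
  | .imp φ ψ, e, E => φ.Realize M e E → ψ.Realize M e E
  | .iff φ ψ, e, E => (φ.Realize M e E ↔ ψ.Realize M e E)
  | .all₁ x φ, e, E => ∀ a : M.carrier, φ.Realize M (Function.update e x a) E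
  | .ex₁ x φ, e, E => ∃ a : M.carrier, φ.Realize M (Function.update e x a) E
  | .all₂ X φ, e, E => ∀ Y : M.sets, φ.Realize M e (Function.update E X Y)
  | .ex₂ X φ, e, E => ∃ Y : M.sets, φ.Realize M e (Function.update E X Y)

/-- The universal closure of `φ` holds in `M`. -/
def Model.Satisfies (M : Model.{u}) (φ : Formula) : Prop :=
  ∀ (e : ℕ → M.carrier) (E : ℕ → M.sets), φ.Realize M e E

/-- `φ` is a theorem of the theory `T` (a set of formulas, each standing for its universal closure):
`φ` holds in every structure, standard or not, in which all of `T` holds.  By the completeness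
theorem for two-sorted first-order logic this is derivability from `T`. -/
def IsTheoremOf (T : Set Formula) (φ : Formula) : Prop :=
  ∀ M : Model.{u}, (∀ ψ ∈ T, M.Satisfies ψ) → M.Satisfies φ

/-! ### Writing formulas with bound variables chosen automatically

An `Fm` is a formula waiting for a number `d` such that all variables in scope have names below
`d`; a quantifier gives its variable the name `d` and passes `d + 1` on to its scope, so no
variable is ever captured.  A sentence is obtained by starting with `d = 0`. -/

abbrev Fm : Type := ℕ → Formula

namespace Fm

def eq (s t : Term) : Fm := fun _ => .eq s t
def lt (s t : Term) : Fm := fun _ => .lt s t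
def mem (t : Term) (X : ℕ) : Fm := fun _ => .mem t X
def neg (φ : Fm) : Fm := fun d => .neg (φ d)
def and (φ ψ : Fm) : Fm := fun d => .and (φ d) (ψ d)
def or (φ ψ : Fm) : Fm := fun d => .or (φ d) (ψ d)
def imp (φ ψ : Fm) : Fm := fun d => .imp (φ d) (ψ d)
def iff (φ ψ : Fm) : Fm := fun d => .iff (φ d) (ψ d)
def all₁ (f : Term → Fm) : Fm := fun d => .all₁ d (f (.var d) (d + 1))
def ex₁ (f : Term → Fm) : Fm := fun d => .ex₁ d (f (.var d) (d + 1))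
def all₂ (f : ℕ → Fm) : Fm := fun d => .all₂ d (f d (d + 1))
def ex₂ (f : ℕ → Fm) : Fm := fun d => .ex₂ d (f d (d + 1))

end Fm

infix:50 " ≐ " => Fm.eq
infix:50 " ⋖₁ " => Fm.lt
infix:50 " ∈₂ " => Fm.mem
prefix:max "∼" => Fm.neg
infixr:35 " ⋏ " => Fm.and
infixr:30 " ⋎ " => Fm.or
infixr:25 " ⟹ " => Fm.imp
infix:20 " ⟺ " => Fm.iff

open Fm

def le (s t : Term) : Fm := s ⋖₁ t ⋎ s ≐ t

/-- There is exactly one number with the property `f`. -/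
def exUnique (f : Term → Fm) : Fm := ex₁ fun x => f x ⋏ all₁ fun y => f y ⟹ y ≐ x

/-- `∀ x ∈ X` and `∃ x ∈ X`. -/
def allIn (X : ℕ) (f : Term → Fm) : Fm := all₁ fun x => x ∈₂ X ⟹ f x
def exIn (X : ℕ) (f : Term → Fm) : Fm := ex₁ fun x => x ∈₂ X ⋏ f x

/-! ### The theory `RCA₀` -/

/-- The axioms of a commutative discrete ordered semiring. -/
def basicAxioms : List Fm :=
  [ all₁ fun x => all₁ fun y => all₁ fun z => (x + y) + z ≐ x + (y + z),
    all₁ fun x => all₁ fun y => x + y ≐ y + x,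
    all₁ fun x => all₁ fun y => all₁ fun z => (x * y) * z ≐ x * (y * z),
    all₁ fun x => all₁ fun y => x * y ≐ y * x,
    all₁ fun x => all₁ fun y => all₁ fun z => x * (y + z) ≐ x * y + x * z,
    all₁ fun x => x + 0 ≐ x,
    all₁ fun x => x * 0 ≐ 0,
    all₁ fun x => x * 1 ≐ x,
    all₁ fun x => all₁ fun y => all₁ fun z => (x ⋖₁ y ⋏ y ⋖₁ z) ⟹ x ⋖₁ z,
    all₁ fun x => ∼(x ⋖₁ x),
    all₁ fun x => all₁ fun y => x ⋖₁ y ⋎ x ≐ y ⋎ y ⋖₁ x,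
    all₁ fun x => all₁ fun y => all₁ fun z => x ⋖₁ y ⟹ x + z ⋖₁ y + z,
    all₁ fun x => all₁ fun y => all₁ fun z => (0 ⋖₁ z ⋏ x ⋖₁ y) ⟹ x * z ⋖₁ y * z,
    all₁ fun x => all₁ fun y => x ⋖₁ y ⟹ ex₁ fun z => x + z ≐ y,
    0 ⋖₁ 1,
    all₁ fun x => 0 ⋖₁ x ⟹ le 1 x,
    all₁ fun x => le 0 x ]

/-- Formulas with bounded number quantifiers only. -/
inductive IsBounded : Formula → Prop
  | eq (s t : Term) : IsBounded (.eq s t)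
  | lt (s t : Term) : IsBounded (.lt s t)
  | mem (t : Term) (X : ℕ) : IsBounded (.mem t X)
  | neg {φ : Formula} : IsBounded φ → IsBounded (.neg φ)
  | and {φ ψ : Formula} : IsBounded φ → IsBounded ψ → IsBounded (.and φ ψ)
  | or {φ ψ : Formula} : IsBounded φ → IsBounded ψ → IsBounded (.or φ ψ)
  | imp {φ ψ : Formula} : IsBounded φ → IsBounded ψ → IsBounded (.imp φ ψ)
  | iff {φ ψ : Formula} : IsBounded φ → IsBounded ψ → IsBounded (.iff φ ψ)
  | all {x : ℕ} {t : Term} {φ : Formula} : x ∉ t.vars → IsBounded φ →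
      IsBounded (.all₁ x (.imp (.lt (.var x) t) φ))
  | ex {x : ℕ} {t : Term} {φ : Formula} : x ∉ t.vars → IsBounded φ →
      IsBounded (.ex₁ x (.and (.lt (.var x) t) φ))

def IsSigma1 (φ : Formula) : Prop := ∃ k θ, IsBounded θ ∧ φ = .ex₁ k θ

def IsPi1 (φ : Formula) : Prop := ∃ k θ, IsBounded θ ∧ φ = .all₁ k θ

/-- The formula `φ(t)`, where `φ = φ(n)`, written without substitution as
`∀ m (m = t → ∀ n (n = m → φ))`; here `m` is not `n`, not in `t` and not free in `φ`. -/
def Formula.inst (φ : Formula) (n m : ℕ) (t : Term) : Formula :=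
  .all₁ m (.imp (.eq (.var m) t) (.all₁ n (.imp (.eq (.var n) (.var m)) φ)))

/-- The induction axiom `(φ(0) ∧ ∀ n (φ(n) → φ(n + 1))) → ∀ n φ(n)`. -/
def inductionAxiom (φ : Formula) (n m : ℕ) : Formula :=
  .imp (.and (φ.inst n m 0) (.all₁ n (.imp φ (φ.inst n m (.var n + 1))))) (.all₁ n φ)

/-- The comprehension axiom `∀ n (φ(n) ↔ ψ(n)) → ∃ X ∀ n (n ∈ X ↔ φ(n))`. -/
def comprehensionAxiom (φ ψ : Formula) (n X : ℕ) : Formula :=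
  .imp (.all₁ n (.iff φ ψ)) (.ex₂ X (.all₁ n (.iff (.mem (.var n) X) φ)))

/-- Basic axioms, `Σ⁰₁` induction and `Δ⁰₁` comprehension. -/
def RCA₀ : Set Formula :=
  {χ | ∃ A ∈ basicAxioms, χ = A 0} ∪
  {χ | ∃ φ n m, IsSigma1 φ ∧ m ≠ n ∧ m ∉ φ.freeNum ∧ χ = inductionAxiom φ n m} ∪
  {χ | ∃ φ ψ n X, IsSigma1 φ ∧ IsPi1 ψ ∧ X ∉ φ.freeSet ∧ χ = comprehensionAxiom φ ψ n X}

/-! ### Coding of pairs, functions, finite sets and finite sequences -/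

/-- The pairing map `(s, t) = (s + t)² + s`. -/
def pair (s t : Term) : Term := (s + t) * (s + t) + s

/-- `f : D → C`, where `graph c` says that `c` is in the set of pairs `f`. -/
def isFunction (graph dom cod : Term → Fm) : Fm :=
  (all₁ fun c => graph c ⟹ ex₁ fun y => ex₁ fun z => c ≐ pair y z ⋏ dom y ⋏ cod z) ⋏
  (all₁ fun y => dom y ⟹ exUnique fun z => graph (pair y z))

/-- The property common to all numbers. -/
def anyNumber (_ : Term) : Fm := (0 : Term) ≐ 0

def divides (s t : Term) : Fm := ex₁ fun q => t ≐ s * q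

/-- `c = (k, (m, n))`, `i < k` and `m (i + 1) + 1` divides `n`, for some `k, m, n`. -/
def inCode (i c : Term) : Fm :=
  ex₁ fun k => ex₁ fun m => ex₁ fun n =>
    c ≐ pair k (pair m n) ⋏ i ⋖₁ k ⋏ divides (m * (i + 1) + 1) n

def isTriple (c : Term) : Fm :=
  ex₁ fun k => ex₁ fun m => ex₁ fun n => c ≐ pair k (pair m n)

/-- `c` is the code of a finite set: the least triple that determines this set through `inCode`.
So every finite (that is, bounded) set has exactly one code. -/
def isFinSetCode (c : Term) : Fm :=
  isTriple c ⋏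
  all₁ fun b => (b ⋖₁ c ⋏ isTriple b) ⟹ ∼(all₁ fun i => inCode i b ⟺ inCode i c)

/-- `s` is the code of a finite sequence of length `l`, that is, of the finite set of pairs
`(i, s(i))`, `i < l`. -/
def isSeq (s l : Term) : Fm :=
  isFinSetCode s ⋏ isFunction (fun c => inCode c s) (fun i => i ⋖₁ l) anyNumber

/-- `s(i) = j`. -/
def entry (s i j : Term) : Fm := inCode (pair i j) s

/-! ### Countable algebras of sets and ultrafilters

`v ∈ A_i` is written `pair i v ∈₂ A`. -/

/-- `A` is a countable algebra over `V`. -/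
def isAlgebra (V A : ℕ) : Fm :=
  (all₁ fun i => all₁ fun v => pair i v ∈₂ A ⟹ v ∈₂ V) ⋏
  (ex₁ fun i => all₁ fun v => pair i v ∈₂ A ⟺ v ∈₂ V) ⋏
  (all₁ fun i => all₁ fun j => ex₁ fun k => all₁ fun v =>
    pair k v ∈₂ A ⟺ (pair i v ∈₂ A ⋎ pair j v ∈₂ A)) ⋏
  (all₁ fun i => all₁ fun j => ex₁ fun k => all₁ fun v =>
    pair k v ∈₂ A ⟺ (pair i v ∈₂ A ⋏ pair j v ∈₂ A)) ⋏
  (all₁ fun i => ex₁ fun k => all₁ fun v =>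
    pair k v ∈₂ A ⟺ (v ∈₂ V ⋏ ∼(pair i v ∈₂ A)))

/-- `A_k = {d}`. -/
def isSingleton (A : ℕ) (k d : Term) : Fm := all₁ fun v => pair k v ∈₂ A ⟺ v ≐ d

def isAtomic (V A : ℕ) : Fm := allIn V fun v => ex₁ fun k => isSingleton A k v

/-- `U` is an ultrafilter on the algebra `A` over `V`. -/
def isUltrafilter (V A U : ℕ) : Fm :=
  (all₁ fun i => (all₁ fun v => pair i v ∈₂ A ⟺ v ∈₂ V) ⟹ i ∈₂ U) ⋏
  (all₁ fun i => (all₁ fun v => ∼(pair i v ∈₂ A)) ⟹ ∼(i ∈₂ U)) ⋏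
  (all₁ fun i => all₁ fun j =>
    (i ∈₂ U ⋏ all₁ fun v => pair i v ∈₂ A ⟹ pair j v ∈₂ A) ⟹ j ∈₂ U) ⋏
  (all₁ fun i => all₁ fun j => all₁ fun k =>
    (i ∈₂ U ⋏ j ∈₂ U ⋏ all₁ fun v => pair k v ∈₂ A ⟺ (pair i v ∈₂ A ⋏ pair j v ∈₂ A)) ⟹
      k ∈₂ U) ⋏
  (all₁ fun i => all₁ fun j =>
    (all₁ fun v => pair j v ∈₂ A ⟺ (v ∈₂ V ⋏ ∼(pair i v ∈₂ A))) ⟹ (i ∈₂ U ⋎ j ∈₂ U))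

def isPrincipal (A U : ℕ) : Fm := ex₁ fun k => ex₁ fun d => k ∈₂ U ⋏ isSingleton A k d

/-! ### Weak orders and profiles -/

/-- `x ≲_R y` for the finite relation with code `R`. -/
def leR (R x y : Term) : Fm := inCode (pair x y) R

/-- `x <_R y`. -/
def ltR (R x y : Term) : Fm := leR R x y ⋏ ∼(leR R y x)

/-- `R ∈ W`: `R` is the code of a weak order on `X`. -/
def isWeakOrder (X : ℕ) (R : Term) : Fm :=
  isFinSetCode R ⋏
  (all₁ fun c => inCode c R ⟹ exIn X fun x => exIn X fun y => c ≐ pair x y) ⋏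
  (allIn X fun x => allIn X fun y => leR R x y ⋎ leR R y x) ⋏
  (allIn X fun x => allIn X fun y => allIn X fun z => (leR R x y ⋏ leR R y z) ⟹ leR R x z)

/-- `F` is a sequence of profiles `f_i : V → W`; `R = f_i(v)` is written
`pair i (pair v R) ∈₂ F`. -/
def isProfileSeq (V X F : ℕ) : Fm :=
  all₁ fun i => isFunction (fun c => pair i c ∈₂ F) (fun v => v ∈₂ V) (isWeakOrder X)

/-- `x ≲_{i(v)} y`. -/
def leP (F : ℕ) (i v x y : Term) : Fm := ex₁ fun R => pair i (pair v R) ∈₂ F ⋏ leR R x y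

/-- `x <_{i(v)} y`. -/
def ltP (F : ℕ) (i v x y : Term) : Fm := ex₁ fun R => pair i (pair v R) ∈₂ F ⋏ ltR R x y

/-! ### Countable societies -/

/-- `F` is uniformly `A`-measurable: there is `μ : ℕ × X × X → ℕ` with
`x ≲_{n(v)} y ↔ v ∈ A_{μ(n, x, y)}`. -/
def isUniformlyMeasurable (V X A F : ℕ) : Fm :=
  ex₂ fun μ =>
    isFunction (fun c => c ∈₂ μ)
      (fun t => ex₁ fun n => exIn X fun x => exIn X fun y => t ≐ pair (pair n x) y)
      anyNumber ⋏
    all₁ fun n => allIn X fun x => allIn X fun y => allIn V fun v =>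
      leP F n v x y ⟺ ex₁ fun k => pair (pair (pair n x) y) k ∈₂ μ ⋏ pair k v ∈₂ A

/-- `p` is a permutation of `W` of length `l`: a sequence of elements of `W` in which each element
of `W` occurs exactly once.  In particular `l` is the number of elements of `W`. -/
def isPerm (X : ℕ) (p l : Term) : Fm :=
  isSeq p l ⋏
  (all₁ fun i => all₁ fun R => entry p i R ⟹ isWeakOrder X R) ⋏
  (all₁ fun R => isWeakOrder X R ⟹ exUnique fun i => entry p i R)

/-- `s` is a sequence of length `l`, where `1 ≤ l ≤ k`. -/
def isQPart (k s l : Term) : Fm := isSeq s l ⋏ le 1 l ⋏ le l k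

/-- `A` is quasi-partition embedded into `F`: there is a function `e` on all pairs of a permutation
`p` of `W` and a sequence `s` with `1 ≤ lh s ≤ |W|` such that, for `n = e(p, s)` and `v ∈ V`,
`f_n(v) = p(i)` if `i` is the unique `i < lh s - 1` with `v ∈ A_{s(i)}`, and
`f_n(v) = p(lh s - 1)` if there is no such unique `i`. -/
def isQPEmbedded (V X A F : ℕ) : Fm :=
  ex₂ fun e =>
    isFunction (fun c => c ∈₂ e)
      (fun t => ex₁ fun p => ex₁ fun s => ex₁ fun k => ex₁ fun l =>
        isPerm X p k ⋏ isQPart k s l ⋏ t ≐ pair p s)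
      anyNumber ⋏
    all₁ fun p => all₁ fun s => all₁ fun k => all₁ fun l => all₁ fun n =>
      (isPerm X p k ⋏ isQPart k s l ⋏ pair (pair p s) n ∈₂ e) ⟹
        allIn V fun v => all₁ fun R => pair n (pair v R) ∈₂ F ⟹
          let hit : Term → Fm := fun i =>
            i + 1 ⋖₁ l ⋏ ex₁ fun a => entry s i a ⋏ pair a v ∈₂ A
          (all₁ fun i => (hit i ⋏ all₁ fun j => hit j ⟹ j ≐ i) ⟹ entry p i R) ⋏
          (∼(exUnique hit) ⟹ ex₁ fun j => j + 1 ≐ l ⋏ entry p j R)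

/-- `V, X, A, F` form a countable society. -/
def isSociety (V X A F : ℕ) : Fm :=
  (ex₁ fun v => v ∈₂ V) ⋏
  (ex₁ fun b => allIn X fun x => x ⋖₁ b) ⋏
  (exIn X fun x => exIn X fun y => exIn X fun z => ∼(x ≐ y) ⋏ ∼(x ≐ z) ⋏ ∼(y ≐ z)) ⋏
  isAlgebra V A ⋏ isAtomic V A ⋏ isProfileSeq V X F ⋏
  isUniformlyMeasurable V X A F ⋏ isQPEmbedded V X A F

/-! ### Social welfare functions -/

/-- `x ≲_{σ(i)} y`. -/
def leS (σ : ℕ) (i x y : Term) : Fm := ex₁ fun R => pair i R ∈₂ σ ⋏ leR R x y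

/-- `x <_{σ(i)} y`. -/
def ltS (σ : ℕ) (i x y : Term) : Fm := ex₁ fun R => pair i R ∈₂ σ ⋏ ltR R x y

/-- `f_i = f_j` on `{x, y}`. -/
def agreeP (V F : ℕ) (i j x y : Term) : Fm :=
  allIn V fun v => all₁ fun a => all₁ fun b =>
    ((a ≐ x ⋎ a ≐ y) ⋏ (b ≐ x ⋎ b ≐ y)) ⟹ (leP F i v a b ⟺ leP F j v a b)

/-- `σ(i) = σ(j)` on `{x, y}`. -/
def agreeS (σ : ℕ) (i j x y : Term) : Fm :=
  all₁ fun a => all₁ fun b =>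
    ((a ≐ x ⋎ a ≐ y) ⋏ (b ≐ x ⋎ b ≐ y)) ⟹ (leS σ i a b ⟺ leS σ j a b)

/-- `σ : ℕ → W` is a social welfare function: unanimity and independence. -/
def isSWF (V X F σ : ℕ) : Fm :=
  isFunction (fun c => c ∈₂ σ) anyNumber (isWeakOrder X) ⋏
  (allIn X fun x => allIn X fun y => all₁ fun i =>
    (allIn V fun v => ltP F i v x y) ⟹ ltS σ i x y) ⋏
  (allIn X fun x => allIn X fun y => all₁ fun i => all₁ fun j =>
    agreeP V F i j x y ⟹ agreeS σ i j x y)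

/-- `A_n` is `σ`-decisive. -/
def isDecisive (X A F σ : ℕ) (n : Term) : Fm :=
  allIn X fun x => allIn X fun y => all₁ fun i =>
    (all₁ fun v => pair n v ∈₂ A ⟹ ltP F i v x y) ⟹ ltS σ i x y

/-- The cofinite coalitions property; cofinitely many `v ∈ V` means all `v ∈ V` from some
number `k` on. -/
def hasCofiniteCoalitions (V X F σ : ℕ) : Fm :=
  all₁ fun j => allIn X fun x => allIn X fun y =>
    (ex₁ fun k => allIn V fun v => le k v ⟹ ltP F j v x y) ⟹ ltS σ j x y

/-- For every countable society and every ultrafilter `U` on its algebra of coalitions there is a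
social welfare function `σ` such that `i ∈ U` iff `A_i` is `σ`-decisive, and such that `U` is
non-principal iff `σ` has the cofinite coalitions property. -/
def converseKS : Formula :=
  (all₂ fun V => all₂ fun X => all₂ fun A => all₂ fun F => all₂ fun U =>
    (isSociety V X A F ⋏ isUltrafilter V A U) ⟹
      ex₂ fun σ =>
        isSWF V X F σ ⋏
        (all₁ fun i => i ∈₂ U ⟺ isDecisive X A F σ i) ⋏
        (∼(isPrincipal A U) ⟺ hasCofiniteCoalitions V X F σ)) 0

end L2

/-! Given an ultrafilter `U`, let `σ(i)` rank `x ≲ y` exactly when the coalition `{v : x ≲_{i(v)}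
y}` belongs to `U`. The coalitions for `x ≲ y` and `y ≲ x` cover `V`, so one of them is in `U` and
the ranking is total; closure under intersections and supersets gives transitivity; independence
holds because only the coalition matters. A coalition in `U` is decisive: the coalition for `x ≲ y`
contains it, and the one for `y ≲ x` is disjoint from it. If `A_i` is not in `U`, its complement is,
hence is decisive; a profile in which `A_i` and its complement have opposite strict preferences
(`exists_opposed_profile`) then shows that `A_i` is not decisive. The same profile for an atom `{d}`
in `U` refutes the cofinite coalitions property. If `U` is non-principal, it contains coalitions
avoiding any given initial segment (`IsUltrafilter.exists_mem_avoiding`), and their decisiveness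
yields the property.

The work lies in doing this inside an arbitrary model of `RCA₀`. Uniform measurability makes "the
coalition belongs to `U`" a `Δ⁰₁` condition (`exists_measure`), but each value of `σ` must be the
code of a weak order, so bounded sets of the model need codes. This is `IsRCA.exists_code_bound`: if
`m` is a multiple of all small differences, the moduli `m(i+1)+1` are pairwise coprime, and a set is
coded by the product of the moduli of its elements. The opposed profile comes from the
quasi-partition embedding, which must be fed a permutation of `W` beginning with two prescribed
orders; `exists_isPerm` builds it by `Σ⁰₁` induction.

Formulas are avoided by working with `Delta0`, the relations on the carrier generated by the
operations of bounded formulas. `Delta0.exists_formula` turns such a relation back into a formula,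
so `Model.isRCA` provides induction and comprehension for relations. -/

namespace L2

/-! ### Discretely ordered semirings: pairing, divisibility, coprime moduli -/

section Arithmetic

/-- A discretely ordered semiring: there is nothing strictly between `0` and `1`. -/
class DiscreteSemiring (N : Type u) extends CommSemiring N, LinearOrder N,
    IsStrictOrderedRing N, CanonicallyOrderedAdd N where
  one_le_of_pos : ∀ x : N, 0 < x → 1 ≤ x

variable {N : Type u} [DiscreteSemiring N]

theorem add_one_le_of_lt {a b : N} (h : a < b) : a + 1 ≤ b := by
  obtain ⟨c, rfl⟩ := exists_add_of_le h.le
  have hc : 0 < c := by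
    rcases eq_or_lt_of_le (zero_le (a := c)) with h0 | h0
    · rw [← h0, add_zero] at h; exact absurd h (lt_irrefl a)
    · exact h0
  gcongr
  exact DiscreteSemiring.one_le_of_pos c hc

theorem lt_add_one_iff_le {a b : N} : a < b + 1 ↔ a ≤ b := by
  constructor
  · intro h
    by_contra hb
    exact absurd (lt_of_lt_of_le h (add_one_le_of_lt (not_le.1 hb))) (lt_irrefl a)
  · intro h
    exact lt_of_le_of_lt h (lt_add_one b)

theorem le_mul_self_of_discrete (a : N) : a ≤ a * a := by
  rcases eq_or_lt_of_le (zero_le (a := a)) with h0 | h0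
  · rw [← h0, mul_zero]
  · exact le_mul_of_one_le_right zero_le (DiscreteSemiring.one_le_of_pos a h0)

/-- The pairing map. -/
def pr (a b : N) : N := (a + b) * (a + b) + a

theorem le_pr_left (a b : N) : a ≤ pr a b := le_add_self

theorem le_pr_right (a b : N) : b ≤ pr a b :=
  calc b ≤ a + b := le_add_self
    _ ≤ (a + b) * (a + b) := le_mul_self_of_discrete _
    _ ≤ pr a b := le_self_add

theorem pr_mono {a b c d : N} (h : a ≤ c) (h' : b ≤ d) : pr a b ≤ pr c d := by
  unfold pr; gcongr

/-- With `s = a + b`, the value lies between `s²` and `s² + s`, hence below `(s + 1)²`; so pairs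
with different sums occupy disjoint intervals. -/
theorem pr_lt_of_add_lt {a b c d : N} (h : a + b < c + d) : pr a b < pr c d := by
  have h1 : a + b + 1 ≤ c + d := add_one_le_of_lt h
  calc pr a b ≤ (a + b) * (a + b) + (a + b) := by unfold pr; gcongr; exact le_self_add
    _ ≤ (a + b) * (a + b) + (a + b) + (a + b) := le_self_add
    _ < (a + b) * (a + b) + (a + b) + (a + b) + 1 := lt_add_one _
    _ = (a + b + 1) * (a + b + 1) := by ring
    _ ≤ (c + d) * (c + d) := by gcongr
    _ ≤ pr c d := le_self_add

theorem pr_inj {a b c d : N} : pr a b = pr c d ↔ a = c ∧ b = d := by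
  constructor
  · intro h
    have hs : a + b = c + d := by
      rcases lt_trichotomy (a + b) (c + d) with h1 | h1 | h1
      · exact absurd h (pr_lt_of_add_lt h1).ne
      · exact h1
      · exact absurd h (pr_lt_of_add_lt h1).ne'
    have ha : a = c := by
      unfold pr at h
      rw [hs] at h
      exact add_left_cancel h
    subst ha
    exact ⟨rfl, add_left_cancel hs⟩
  · rintro ⟨rfl, rfl⟩; rfl

/-- Without subtraction one compares the two quotients: their difference is the quotient for `c`,
unless the order is reversed, which forces `c = 0`. -/
theorem dvd_of_dvd_add {a b c : N} (h : a ∣ b + c) (h' : a ∣ b) : a ∣ c := by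
  obtain ⟨x, hx⟩ := h
  obtain ⟨y, rfl⟩ := h'
  rcases le_total y x with hxy | hxy
  · obtain ⟨z, rfl⟩ := exists_add_of_le hxy
    rw [mul_add] at hx
    exact ⟨z, add_left_cancel hx⟩
  · have h1 : a * y + c ≤ a * y + 0 := by rw [hx, add_zero]; gcongr
    have h2 : c = 0 := le_antisymm (le_of_add_le_add_left h1) zero_le
    rw [h2]; exact dvd_zero a

theorem le_of_dvd_of_pos {a b : N} (hb : 0 < b) (h : a ∣ b) : a ≤ b := by
  obtain ⟨q, rfl⟩ := h
  have hq : 0 < q := pos_of_mul_pos_right hb zero_le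
  exact le_mul_of_one_le_right zero_le (DiscreteSemiring.one_le_of_pos q hq)

/-- This bounds the quotient, so that divisibility becomes a bounded relation. If `a = 0` the
quotient is arbitrary and `0` is chosen. -/
theorem exists_mul_le (a b : N) : (∃ q, b = a * q) ↔ ∃ q, q < b + 1 ∧ b = a * q := by
  constructor
  · rintro ⟨q, rfl⟩
    rcases eq_or_lt_of_le (zero_le (a := a)) with h0 | h0
    · exact ⟨0, by rw [← h0]; simp, by rw [← h0]; simp⟩
    · exact ⟨q, lt_add_one_iff_le.2
        (le_mul_of_one_le_left zero_le (DiscreteSemiring.one_le_of_pos a h0)), rfl⟩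
  · rintro ⟨q, -, h⟩; exact ⟨q, h⟩

/-- The moduli used in the coding of finite sets. -/
def modulus (m i : N) : N := m * (i + 1) + 1

theorem modulus_pos (m i : N) : 0 < modulus m i := by unfold modulus; positivity

theorem modulus_ne_one {m : N} (hm : 0 < m) (i : N) : ¬ modulus m i ∣ 1 := by
  intro h
  have h1 : modulus m i ≤ 1 := le_of_dvd_of_pos zero_lt_one h
  have h2 : 0 < m * (i + 1) := mul_pos hm (by positivity)
  have h3 : 0 + 1 < modulus m i := by unfold modulus; gcongr
  rw [zero_add] at h3
  exact absurd (lt_of_lt_of_le h3 h1) (lt_irrefl _)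

/-- Modulo `m(i+1)+1` the number `m` is invertible, with inverse `-(i+1)`. Hence `m` can be
cancelled. -/
theorem dvd_of_modulus_dvd_mul {m i x : N} (h : modulus m i ∣ x * m) : modulus m i ∣ x := by
  have h1 : modulus m i ∣ x * m * (i + 1) + x :=
    ⟨x, by unfold modulus; ring⟩
  exact dvd_of_dvd_add h1 (h.mul_right _)

/-- If all differences of indices divide `m`, then the moduli satisfy Euclid's lemma. -/
theorem modulus_dvd_of_dvd_mul {m k i j x : N} (hm : ∀ D, D < k → 0 < D → D ∣ m) (hi : i < k)
    (hj : j < k) (hij : i ≠ j) (h : modulus m i ∣ x * modulus m j) : modulus m i ∣ x := by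
  -- Two moduli differ by `m * D`, where `D` is the difference of the indices. Cancel `m`, multiply
  -- by the cofactor of `D` in `m` to replace `D` by `m`, and cancel `m` again.
  have key : ∀ D, 0 < D → D < k → modulus m i ∣ x * m * D → modulus m i ∣ x := by
    intro D hD hDk hd
    obtain ⟨t, ht⟩ := hm D hDk hD
    have h1 : modulus m i ∣ x * D :=
      dvd_of_modulus_dvd_mul (by rwa [mul_right_comm] at hd)
    have h2 : modulus m i ∣ x * m := by
      have h3 := h1.mul_right t
      rwa [mul_assoc, ← ht] at h3
    exact dvd_of_modulus_dvd_mul h2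
  have h0 : modulus m i ∣ x * modulus m i := dvd_mul_left _ _
  rcases lt_or_gt_of_ne hij with hlt | hlt
  · obtain ⟨D, rfl⟩ := exists_add_of_le hlt.le
    have hD : 0 < D := by
      by_contra hc
      rw [not_lt] at hc
      rw [le_antisymm hc zero_le, add_zero] at hlt
      exact lt_irrefl _ hlt
    refine key D hD (lt_of_le_of_lt le_add_self hj) ?_
    refine dvd_of_dvd_add (b := x * modulus m i) ?_ h0
    convert h using 1
    unfold modulus; ring
  · obtain ⟨D, rfl⟩ := exists_add_of_le hlt.le
    have hD : 0 < D := by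
      by_contra hc
      rw [not_lt] at hc
      rw [le_antisymm hc zero_le, add_zero] at hlt
      exact lt_irrefl _ hlt
    refine key D hD (lt_of_le_of_lt le_add_self hi) ?_
    refine dvd_of_dvd_add (b := x * modulus m j) ?_ h
    convert h0 using 1
    unfold modulus; ring

end Arithmetic

/-! ### Relations definable by bounded formulas with parameters -/

section Delta0

variable {N : Type u} [DiscreteSemiring N]

/-- Polynomial functions, that is, values of terms with parameters. -/
inductive Poly : ∀ {n : ℕ}, ((Fin n → N) → N) → Prop
  | var {n : ℕ} (i : Fin n) : Poly fun v => v i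
  | const {n : ℕ} (c : N) : Poly fun _ : Fin n → N => c
  | add {n : ℕ} {s t : (Fin n → N) → N} : Poly s → Poly t → Poly fun v => s v + t v
  | mul {n : ℕ} {s t : (Fin n → N) → N} : Poly s → Poly t → Poly fun v => s v * t v

theorem Poly.pr {n : ℕ} {s t : (Fin n → N) → N} (hs : Poly s) (ht : Poly t) :
    Poly fun v => pr (s v) (t v) := ((hs.add ht).mul (hs.add ht)).add hs

theorem Poly.shift {n : ℕ} {r : (Fin n → N) → N} (hr : Poly r) :
    Poly fun w : Fin (n + 1) → N => r fun i => w i.castSucc := by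
  induction hr with
  | var i => exact Poly.var _
  | const c => exact Poly.const c
  | add _ _ h1 h2 => exact h1.add h2
  | mul _ _ h1 h2 => exact h1.mul h2

/-- Relations defined by bounded formulas with number parameters and with set parameters from
`S`. -/
inductive Delta0 (S : Set (Set N)) : ∀ {n : ℕ}, ((Fin n → N) → Prop) → Prop
  | eq {n : ℕ} {s t : (Fin n → N) → N} : Poly s → Poly t → Delta0 S fun v => s v = t v
  | lt {n : ℕ} {s t : (Fin n → N) → N} : Poly s → Poly t → Delta0 S fun v => s v < t v
  | mem {n : ℕ} {s : (Fin n → N) → N} {Z : Set N} : Poly s → Z ∈ S → Delta0 S fun v => s v ∈ Z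
  | neg {n : ℕ} {P : (Fin n → N) → Prop} : Delta0 S P → Delta0 S fun v => ¬ P v
  | and {n : ℕ} {P Q : (Fin n → N) → Prop} : Delta0 S P → Delta0 S Q → Delta0 S fun v => P v ∧ Q v
  | bex {n : ℕ} {t : (Fin n → N) → N} {P : (Fin n → N) → N → Prop} : Poly t →
      Delta0 S (fun w : Fin (n + 1) → N => P (fun i => w i.castSucc) (w (Fin.last n))) →
      Delta0 S fun v => ∃ a, a < t v ∧ P v a

variable {S : Set (Set N)} {n : ℕ} {P Q : (Fin n → N) → Prop} {s t : (Fin n → N) → N}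

theorem Delta0.congr (h : Delta0 S P) (hPQ : ∀ v, P v ↔ Q v) : Delta0 S Q := by
  have : P = Q := funext fun v => propext (hPQ v)
  exact this ▸ h

theorem Delta0.or (hP : Delta0 S P) (hQ : Delta0 S Q) : Delta0 S fun v => P v ∨ Q v :=
  (hP.neg.and hQ.neg).neg.congr fun v => by tauto

theorem Delta0.imp (hP : Delta0 S P) (hQ : Delta0 S Q) : Delta0 S fun v => P v → Q v :=
  (hP.and hQ.neg).neg.congr fun v => by tauto

theorem Delta0.iff (hP : Delta0 S P) (hQ : Delta0 S Q) : Delta0 S fun v => (P v ↔ Q v) :=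
  ((hP.imp hQ).and (hQ.imp hP)).congr fun v => by tauto

theorem Delta0.ball {P : (Fin n → N) → N → Prop} (ht : Poly t)
    (hP : Delta0 S (fun w : Fin (n + 1) → N => P (fun i => w i.castSucc) (w (Fin.last n)))) :
    Delta0 S fun v => ∀ a, a < t v → P v a :=
  (Delta0.bex (P := fun v a => ¬ P v a) ht hP.neg).neg.congr fun _ => by push Not; rfl

/-- A quantifier with an implicit bound. -/
theorem Delta0.ex_of_le {P : (Fin n → N) → N → Prop} (t : (Fin n → N) → N) (ht : Poly t)
    (hb : ∀ v a, P v a → a ≤ t v)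
    (hP : Delta0 S (fun w : Fin (n + 1) → N => P (fun i => w i.castSucc) (w (Fin.last n)))) :
    Delta0 S fun v => ∃ a, P v a :=
  (Delta0.bex (ht.add (Poly.const 1)) hP).congr fun v =>
    ⟨fun ⟨a, _, h⟩ => ⟨a, h⟩, fun ⟨a, h⟩ => ⟨a, lt_add_one_iff_le.2 (hb v a h), h⟩⟩

theorem Delta0.all_of_le {P : (Fin n → N) → N → Prop} (t : (Fin n → N) → N) (ht : Poly t)
    (hb : ∀ v a, ¬ P v a → a ≤ t v)
    (hP : Delta0 S (fun w : Fin (n + 1) → N => P (fun i => w i.castSucc) (w (Fin.last n)))) :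
    Delta0 S fun v => ∀ a, P v a :=
  (Delta0.ex_of_le (P := fun v a => ¬ P v a) t ht hb hP.neg).neg.congr fun _ => by
    push Not; rfl

theorem Delta0.dvd (hs : Poly s) (ht : Poly t) : Delta0 S fun v => s v ∣ t v :=
  (Delta0.bex (P := fun v q => t v = s v * q) (ht.add (Poly.const 1)) (by
    exact Delta0.eq ht.shift (hs.shift.mul (Poly.var _)))).congr
    fun v => (exists_mul_le (s v) (t v)).symm

end Delta0

/-! ### Definability of the coding of finite sets -/

section Coding

variable {N : Type u} [DiscreteSemiring N]

/-- `i` belongs to the finite set coded by `c`. -/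
def InCode (i c : N) : Prop :=
  ∃ k m n, c = pr k (pr m n) ∧ i < k ∧ modulus m i ∣ n

def IsTriple (c : N) : Prop := ∃ k m n : N, c = pr k (pr m n)

def IsFinSetCode (c : N) : Prop :=
  IsTriple c ∧ ∀ b, (b < c ∧ IsTriple b) → ¬ ∀ i, InCode i b ↔ InCode i c

theorem inCode_triple {i k m n : N} : InCode i (pr k (pr m n)) ↔ i < k ∧ modulus m i ∣ n := by
  constructor
  · rintro ⟨k', m', n', h, h1, h2⟩
    rw [pr_inj, pr_inj] at h
    rw [h.1, h.2.1, h.2.2]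
    exact ⟨h1, h2⟩
  · exact fun h => ⟨k, m, n, rfl, h⟩

theorem InCode.lt {i c : N} (h : InCode i c) : i < c := by
  obtain ⟨k, m, n, rfl, h1, -⟩ := h
  exact h1.trans_le (le_pr_left _ _)

theorem le_pr_middle (k m n : N) : m ≤ pr k (pr m n) := (le_pr_left m n).trans (le_pr_right _ _)

theorem le_pr_last (k m n : N) : n ≤ pr k (pr m n) := (le_pr_right m n).trans (le_pr_right _ _)

theorem IsFinSetCode.ext {b c : N} (hb : IsFinSetCode b) (hc : IsFinSetCode c)
    (h : ∀ i, InCode i b ↔ InCode i c) : b = c := by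
  rcases lt_trichotomy b c with hlt | heq | hlt
  · exact absurd h (hc.2 b ⟨hlt, hb.1⟩)
  · exact heq
  · exact absurd (fun i => (h i).symm) (hb.2 c ⟨hlt, hc.1⟩)

section Definability

variable {S : Set (Set N)} {n : ℕ} {s t : (Fin n → N) → N}

/-- The pairing map dominates its arguments, so the three components of a triple are bounded by the
triple itself. -/
theorem Delta0.inCode (hs : Poly s) (ht : Poly t) : Delta0 S fun v => InCode (s v) (t v) := by
  refine Delta0.ex_of_le t ht ?_ <| Delta0.ex_of_le _ ht.shift ?_ <|
    Delta0.ex_of_le _ ht.shift.shift ?_ <| .and (.eq ht.shift.shift.shift ?_) <|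
    .and (.lt hs.shift.shift.shift ?_) (.dvd ?_ ?_)
  · rintro v k ⟨m, n, h, -⟩
    rw [h]; exact le_pr_left _ _
  · rintro v m ⟨n, h, -⟩
    rw [h]; exact le_pr_middle _ _ _
  · rintro v n ⟨h, -⟩
    rw [h]; exact le_pr_last _ _ _
  · exact (Poly.var _).pr ((Poly.var _).pr (Poly.var _))
  · exact Poly.var _
  · exact ((Poly.var _).mul (hs.shift.shift.shift.add (Poly.const 1))).add (Poly.const 1)
  · exact Poly.var _

theorem Delta0.isTriple (ht : Poly t) : Delta0 S fun v => IsTriple (t v) := by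
  refine Delta0.ex_of_le t ht ?_ <| Delta0.ex_of_le _ ht.shift ?_ <|
    Delta0.ex_of_le _ ht.shift.shift ?_ <| .eq ht.shift.shift.shift ?_
  · rintro v k ⟨m, n, h⟩
    rw [h]; exact le_pr_left _ _
  · rintro v m ⟨n, h⟩
    rw [h]; exact le_pr_middle _ _ _
  · rintro v n h
    rw [h]; exact le_pr_last _ _ _
  · exact (Poly.var _).pr ((Poly.var _).pr (Poly.var _))

theorem Delta0.isFinSetCode (ht : Poly t) : Delta0 S fun v => IsFinSetCode (t v) := by
  refine .and (.isTriple ht) <| Delta0.all_of_le t ht ?_ <|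
    .imp (.and (.lt (Poly.var _) ht.shift) (.isTriple (Poly.var _))) <| .neg <|
    -- Elements lie below the code of their set, so two coded sets that differ do so below the sum
    -- of the codes.
    Delta0.all_of_le (fun w => w (Fin.last n) + t fun i => w i.castSucc)
      ((Poly.var _).add ht.shift) ?_ <|
    .iff (.inCode (Poly.var _) (Poly.var _)) (.inCode (Poly.var _) ht.shift.shift)
  · intro v b h
    push Not at h
    exact h.1.1.le
  · intro v i h
    by_cases h1 : InCode i (v (Fin.last n))
    · exact h1.lt.le.trans le_self_add
    · by_cases h2 : InCode i (t fun i => v i.castSucc)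
      · exact h2.lt.le.trans le_add_self
      · exact absurd (iff_of_false h1 h2) h

end Definability

/-! ### Consequences of induction and comprehension: every bounded set has a code -/

/-- `S` is the second-order part of a model of `RCA₀` with first-order part `N`. -/
structure IsRCA (S : Set (Set N)) : Prop where
  sigma_induction : ∀ P : N → N → Prop, Delta0 S (fun v : Fin 2 → N => P (v 0) (v 1)) →
    (∃ a, P 0 a) → (∀ x, (∃ a, P x a) → ∃ a, P (x + 1) a) → ∀ x, ∃ a, P x a
  comprehension : ∀ P Q : N → N → Prop, Delta0 S (fun v : Fin 2 → N => P (v 0) (v 1)) →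
    Delta0 S (fun v : Fin 2 → N => Q (v 0) (v 1)) →
    (∀ x, (∃ a, P x a) ↔ ∀ a, Q x a) → {x | ∃ a, P x a} ∈ S

variable {S : Set (Set N)}


namespace IsRCA

theorem setOf_mem (hS : IsRCA S) {P : N → Prop} (h : Delta0 S fun v : Fin 2 → N => P (v 0)) :
    {x | P x} ∈ S := by
  have := hS.comprehension (fun x _ => P x) (fun x _ => P x) h h (by simp)
  simpa using this

theorem induction (hS : IsRCA S) {P : N → Prop} (h : Delta0 S fun v : Fin 2 → N => P (v 0))
    (h0 : P 0) (h1 : ∀ x, P x → P (x + 1)) (x : N) : P x := by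
  have := hS.sigma_induction (fun x _ => P x) h ⟨0, h0⟩ (fun x ⟨_, hx⟩ => ⟨0, h1 x hx⟩) x
  exact this.elim fun _ h => h

theorem exists_least (hS : IsRCA S) {P : N → Prop} (h : Delta0 S fun v : Fin 2 → N => P (v 0))
    {x : N} (hx : P x) : ∃ y, P y ∧ ∀ z, z < y → ¬ P z := by
  by_contra hc
  push Not at hc
  -- Once `P` is a set of `S`, its instance at the quantified variable `z` is an atomic formula.
  have hZ := hS.setOf_mem h
  have key : ∀ x : N, ∀ z, z < x → z ∉ {x | P x} :=
    hS.induction (.ball (Poly.var 0) (.neg (.mem (Poly.var _) hZ)))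
      (fun z hz => absurd hz not_lt_zero) fun x ih z hz => by
        rcases eq_or_lt_of_le (lt_add_one_iff_le.1 hz) with rfl | hlt
        · intro hPz
          obtain ⟨y, hy, hPy⟩ := hc z hPz
          exact ih y hy hPy
        · exact ih z hlt
  exact key (x + 1) x (lt_add_one x) hx

/-- Every number `k` has a positive common multiple of all positive numbers below it. -/
theorem exists_common_multiple (hS : IsRCA S) (k : N) :
    ∃ m, 0 < m ∧ ∀ D, D < k → 0 < D → D ∣ m := by
  refine hS.sigma_induction (fun k m => 0 < m ∧ ∀ D, D < k → 0 < D → D ∣ m) ?_ ?_ ?_ k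
  · exact .and (.lt (Poly.const 0) (Poly.var 1)) <| .ball (Poly.var 0) <|
      .imp (.lt (Poly.const 0) (Poly.var _)) (.dvd (Poly.var _) (Poly.var _))
  · exact ⟨1, zero_lt_one, fun D h => absurd h not_lt_zero⟩
  · rintro x ⟨m, hm, h⟩
    rcases eq_or_lt_of_le (zero_le (a := x)) with rfl | hx
    -- Multiplying by `x = 0` would destroy positivity; here no positive `D` lies below the bound,
    -- so `1` will do.
    · refine ⟨1, zero_lt_one, fun D h1 h2 => ?_⟩
      exact absurd (lt_of_lt_of_le h2 (lt_add_one_iff_le.1 h1)) (lt_irrefl _)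
    · refine ⟨m * x, mul_pos hm hx, fun D h1 h2 => ?_⟩
      rcases eq_or_lt_of_le (lt_add_one_iff_le.1 h1) with rfl | hlt
      · exact dvd_mul_left _ _
      · exact (h D hlt h2).mul_right x

theorem exists_common_multiple_modulus (hS : IsRCA S) (m k : N) :
    ∃ n, 0 < n ∧ ∀ i, i < k → modulus m i ∣ n := by
  refine hS.sigma_induction (fun k n => 0 < n ∧ ∀ i, i < k → modulus m i ∣ n) ?_ ?_ ?_ k
  · exact .and (.lt (Poly.const 0) (Poly.var 1)) <| .ball (Poly.var 0) <|
      .dvd (((Poly.const m).mul ((Poly.var _).add (Poly.const 1))).add (Poly.const 1))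
        (Poly.var _)
  · exact ⟨1, zero_lt_one, fun D h => absurd h not_lt_zero⟩
  · rintro x ⟨n, hn, h⟩
    refine ⟨n * modulus m x, mul_pos hn (modulus_pos m x), fun i hi => ?_⟩
    rcases eq_or_lt_of_le (lt_add_one_iff_le.1 hi) with rfl | hlt
    · exact dvd_mul_left _ _
    · exact (h i hlt).mul_right _

/-- All bounded sets of `S` below the same bound have codes below a common bound. -/
theorem exists_code_bound (hS : IsRCA S) (k : N) :
    ∃ B, ∀ Z ∈ S, (∀ i ∈ Z, i < k) → ∃ c, c < B ∧ IsFinSetCode c ∧ ∀ i, InCode i c ↔ i ∈ Z := by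
  obtain ⟨m, hm, hdiv⟩ := hS.exists_common_multiple k
  obtain ⟨p, hp, hmul⟩ := hS.exists_common_multiple_modulus m k
  -- The numbers `m` and `p` depend on `k` only, and the third component of the code will be a
  -- divisor of `p`; hence the bound does not depend on `Z`.
  refine ⟨pr k (pr m p) + 1, fun Z hZ hZk => ?_⟩
  -- Here `n` plays the role of the product of the moduli of the elements of `Z` below `j`; all
  -- other moduli can be cancelled against it. Limiting `n` and `y` by `p` keeps the induction
  -- hypothesis bounded.
  have step : ∀ j : N, ∃ n, n < p + 1 ∧ n ∣ p ∧ ∀ i, i < k →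
      ((i ∈ Z ∧ i < j) → modulus m i ∣ n) ∧ (¬ (i ∈ Z ∧ i < j) →
        ∀ y, y < p + 1 → modulus m i ∣ n * y → modulus m i ∣ y) := by
    refine hS.induction ?_ ?_ ?_
    · have hmod : ∀ {l : ℕ} (i : Fin l), Poly fun w : Fin l → N => modulus m (w i) := fun i =>
        ((Poly.const m).mul ((Poly.var i).add (Poly.const 1))).add (Poly.const 1)
      have hin : Delta0 S fun w : Fin 4 → N => w 3 ∈ Z ∧ w 3 < w 0 :=
        .and (.mem (Poly.var _) hZ) (.lt (Poly.var _) (Poly.var _))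
      refine .bex (Poly.const _) <| .and (.dvd (Poly.var _) (Poly.const _)) <|
        .ball (Poly.const _) <| .and (.imp hin (.dvd (hmod _) (Poly.var _))) <|
        .imp hin.neg <| .ball (Poly.const _) <|
        .imp (.dvd (hmod _) ((Poly.var _).mul (Poly.var _))) (.dvd (hmod _) (Poly.var _))
    · refine ⟨1, ?_, one_dvd _, fun i _ => ⟨fun h => absurd h.2 not_lt_zero, fun _ y _ h => ?_⟩⟩
      · exact lt_add_of_pos_left 1 hp
      · rwa [one_mul] at h
    · rintro j ⟨n, hn, hnp, h⟩
      by_cases hj : j ∈ Z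
      · have hjk := hZk j hj
        obtain ⟨y, rfl⟩ := hnp
        have hy : 0 < y := pos_of_mul_pos_right hp zero_le
        have hn0 : 0 < n := pos_of_mul_pos_left hp zero_le
        have hyp : y < n * y + 1 := lt_add_one_iff_le.2
          (le_mul_of_one_le_left zero_le (DiscreteSemiring.one_le_of_pos n hn0))
        -- Now `p = n * y`. The new modulus divides `p` and cancels against `n`, so it divides `y`;
        -- therefore the enlarged product still divides `p`.
        have hqy : modulus m j ∣ y := (h j hjk).2 (fun h => lt_irrefl _ h.2) y hyp (hmul j hjk)
        have hdvd : n * modulus m j ∣ n * y := mul_dvd_mul_left n hqy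
        refine ⟨n * modulus m j, lt_add_one_iff_le.2 (le_of_dvd_of_pos hp hdvd), hdvd,
          fun i hi => ⟨?_, ?_⟩⟩
        · rintro ⟨hiZ, hij⟩
          rcases eq_or_lt_of_le (lt_add_one_iff_le.1 hij) with rfl | hlt
          · exact dvd_mul_left _ _
          · exact ((h i hi).1 ⟨hiZ, hlt⟩).mul_right _
        · intro hni z hz hdz
          have hne : i ≠ j := by
            rintro rfl
            exact hni ⟨hj, lt_add_one i⟩
          refine (h i hi).2 (fun hh => hni ⟨hh.1, hh.2.trans (lt_add_one j)⟩) z hz ?_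
          refine modulus_dvd_of_dvd_mul hdiv hi hjk hne ?_
          rwa [mul_right_comm] at hdz
      · have hiff : ∀ i, (i ∈ Z ∧ i < j + 1) ↔ (i ∈ Z ∧ i < j) := fun i =>
          ⟨fun ⟨h1, h2⟩ => ⟨h1, lt_of_le_of_ne (lt_add_one_iff_le.1 h2) fun h3 => hj (h3 ▸ h1)⟩,
            fun ⟨h1, h2⟩ => ⟨h1, h2.trans (lt_add_one j)⟩⟩
        refine ⟨n, hn, hnp, fun i hi => ?_⟩
        rw [hiff]
        exact h i hi
  obtain ⟨n, hn, -, h⟩ := step k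
  have hcode : ∀ i, InCode i (pr k (pr m n)) ↔ i ∈ Z := by
    intro i
    rw [inCode_triple]
    constructor
    · rintro ⟨hi, hd⟩
      by_contra hiZ
      -- Cancellation with `y = 1` would make a modulus greater than `1` divide `1`.
      refine modulus_ne_one hm i ((h i hi).2 (fun hh => hiZ hh.1) 1 ?_ ?_)
      · exact lt_add_of_pos_left 1 hp
      · rwa [mul_one]
    · intro hi
      exact ⟨hZk i hi, (h i (hZk i hi)).1 ⟨hi, hZk i hi⟩⟩
  have hdef : Delta0 S fun v : Fin 2 → N =>
      IsTriple (v 0) ∧ ∀ i, InCode i (v 0) ↔ i ∈ Z := by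
    refine .and (.isTriple (Poly.var _)) <| .all_of_le (fun w => k + w 0)
      ((Poly.const k).add (Poly.var 0)) ?_ <|
      .iff (.inCode (Poly.var _) (Poly.var _)) (.mem (Poly.var _) hZ)
    intro v i hi
    by_cases h1 : i ∈ Z
    · exact (hZk i h1).le.trans le_self_add
    · by_cases h2 : InCode i (v 0)
      · exact h2.lt.le.trans le_add_self
      · exact absurd (iff_of_false h2 h1) hi
  -- The triple just found need not be the least one for `Z`; the code is the least, and the triple
  -- serves as a bound for it.
  obtain ⟨c, ⟨hc1, hc2⟩, hmin⟩ := hS.exists_least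
    (P := fun c => IsTriple c ∧ ∀ i, InCode i c ↔ i ∈ Z) hdef (x := pr k (pr m n)) ⟨⟨k, m, n, rfl⟩, hcode⟩
  refine ⟨c, ?_, ⟨hc1, ?_⟩, hc2⟩
  · refine lt_add_one_iff_le.2 (le_trans (not_lt.1 fun hlt =>
      hmin _ hlt ⟨⟨k, m, n, rfl⟩, hcode⟩) ?_)
    exact pr_mono le_rfl (pr_mono le_rfl (lt_add_one_iff_le.1 hn))
  · rintro b ⟨hb, hb'⟩ hall
    exact hmin b hb ⟨hb', fun i => (hall i).trans (hc2 i)⟩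

theorem exists_code (hS : IsRCA S) {Z : Set N} (hZ : Z ∈ S) {k : N} (hk : ∀ i ∈ Z, i < k) :
    ∃ c, IsFinSetCode c ∧ ∀ i, InCode i c ↔ i ∈ Z := by
  obtain ⟨B, hB⟩ := hS.exists_code_bound k
  obtain ⟨c, -, hc⟩ := hB Z hZ hk
  exact ⟨c, hc⟩

end IsRCA

end Coding

/-! ### Satisfaction depends only on the free variables -/

section Congruence

variable {M : Model.{u}}

theorem Term.val_congr {e e' : ℕ → M.carrier} (t : Term) (h : ∀ x ∈ t.vars, e x = e' x) :
    t.val M e = t.val M e' := by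
  induction t with
  | var x => exact h x rfl
  | zero => rfl
  | one => rfl
  | add s t hs ht =>
    exact congrArg₂ M.add (hs fun x hx => h x (Or.inl hx)) (ht fun x hx => h x (Or.inr hx))
  | mul s t hs ht =>
    exact congrArg₂ M.mul (hs fun x hx => h x (Or.inl hx)) (ht fun x hx => h x (Or.inr hx))

theorem Formula.realize_congr (φ : Formula) {e e' : ℕ → M.carrier} {E E' : ℕ → M.sets}
    (h : ∀ x ∈ φ.freeNum, e x = e' x) (H : ∀ X ∈ φ.freeSet, E X = E' X) :
    φ.Realize M e E ↔ φ.Realize M e' E' := by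
  induction φ generalizing e e' E E' with
  | eq s t =>
    simp only [Realize]
    rw [s.val_congr fun x hx => h x (Or.inl hx), t.val_congr fun x hx => h x (Or.inr hx)]
  | lt s t =>
    simp only [Realize]
    rw [s.val_congr fun x hx => h x (Or.inl hx), t.val_congr fun x hx => h x (Or.inr hx)]
  | mem t X =>
    simp only [Realize]
    rw [t.val_congr h, H X rfl]
  | neg φ ih => exact not_congr (ih h H)
  | and φ ψ h1 h2 =>
    exact and_congr (h1 (fun x hx => h x (Or.inl hx)) fun x hx => H x (Or.inl hx))
      (h2 (fun x hx => h x (Or.inr hx)) fun x hx => H x (Or.inr hx))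
  | or φ ψ h1 h2 =>
    exact or_congr (h1 (fun x hx => h x (Or.inl hx)) fun x hx => H x (Or.inl hx))
      (h2 (fun x hx => h x (Or.inr hx)) fun x hx => H x (Or.inr hx))
  | imp φ ψ h1 h2 =>
    exact imp_congr (h1 (fun x hx => h x (Or.inl hx)) fun x hx => H x (Or.inl hx))
      (h2 (fun x hx => h x (Or.inr hx)) fun x hx => H x (Or.inr hx))
  | iff φ ψ h1 h2 =>
    exact iff_congr (h1 (fun x hx => h x (Or.inl hx)) fun x hx => H x (Or.inl hx))
      (h2 (fun x hx => h x (Or.inr hx)) fun x hx => H x (Or.inr hx))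
  | all₁ x φ ih =>
    refine forall_congr' fun a => ih (fun y hy => ?_) H
    by_cases hyx : y = x
    · subst hyx; simp
    · simpa [Function.update_of_ne hyx] using h y ⟨hy, hyx⟩
  | ex₁ x φ ih =>
    refine exists_congr fun a => ih (fun y hy => ?_) H
    by_cases hyx : y = x
    · subst hyx; simp
    · simpa [Function.update_of_ne hyx] using h y ⟨hy, hyx⟩
  | all₂ X φ ih =>
    refine forall_congr' fun a => ih h fun y hy => ?_
    by_cases hyx : y = X
    · subst hyx; simp
    · simpa [Function.update_of_ne hyx] using H y ⟨hy, hyx⟩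
  | ex₂ X φ ih =>
    refine exists_congr fun a => ih h fun y hy => ?_
    by_cases hyx : y = X
    · subst hyx; simp
    · simpa [Function.update_of_ne hyx] using H y ⟨hy, hyx⟩

theorem Term.finite_vars (t : Term) : t.vars.Finite := by
  induction t with
  | var x => exact Set.finite_singleton x
  | zero => exact Set.finite_empty
  | one => exact Set.finite_empty
  | add s t hs ht => exact hs.union ht
  | mul s t hs ht => exact hs.union ht

theorem Formula.finite_freeNum (φ : Formula) : φ.freeNum.Finite := by
  induction φ with
  | eq s t => exact s.finite_vars.union t.finite_vars
  | lt s t => exact s.finite_vars.union t.finite_vars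
  | mem t X => exact t.finite_vars
  | neg φ ih => exact ih
  | and φ ψ h1 h2 => exact h1.union h2
  | or φ ψ h1 h2 => exact h1.union h2
  | imp φ ψ h1 h2 => exact h1.union h2
  | iff φ ψ h1 h2 => exact h1.union h2
  | all₁ x φ ih => exact ih.sdiff
  | ex₁ x φ ih => exact ih.sdiff
  | all₂ X φ ih => exact ih
  | ex₂ X φ ih => exact ih

theorem Formula.finite_freeSet (φ : Formula) : φ.freeSet.Finite := by
  induction φ with
  | eq s t => exact Set.finite_empty
  | lt s t => exact Set.finite_empty
  | mem t X => exact Set.finite_singleton X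
  | neg φ ih => exact ih
  | and φ ψ h1 h2 => exact h1.union h2
  | or φ ψ h1 h2 => exact h1.union h2
  | imp φ ψ h1 h2 => exact h1.union h2
  | iff φ ψ h1 h2 => exact h1.union h2
  | all₁ x φ ih => exact ih
  | ex₁ x φ ih => exact ih
  | all₂ X φ ih => exact ih.sdiff
  | ex₂ X φ ih => exact ih.sdiff

/-- The value of `t` is stored in `m` before `n` is rebound, so `t` may contain `n`, as it does in
the step of the induction axiom. -/
theorem Formula.realize_inst {φ : Formula} {n m : ℕ} {t : Term} (hm : m ∉ φ.freeNum)
    (hmn : m ≠ n) (e : ℕ → M.carrier) (E : ℕ → M.sets)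
    (ht : ∀ a, t.val M (Function.update e m a) = t.val M e) :
    (φ.inst n m t).Realize M e E ↔ φ.Realize M (Function.update e n (t.val M e)) E := by
  have key : ∀ a b, φ.Realize M (Function.update (Function.update e m a) n b) E ↔
      φ.Realize M (Function.update e n b) E := by
    intro a b
    refine φ.realize_congr (fun x hx => ?_) fun _ _ => rfl
    have hxm : x ≠ m := by rintro rfl; exact hm hx
    by_cases hxn : x = n
    · subst hxn; simp
    · simp [hxn, hxm]
  simp only [Formula.inst, Formula.Realize, Term.val, ht, Function.update_self, key,
    Function.update_of_ne hmn]
  simp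

end Congruence

/-! ### From models of `RCA₀` to discretely ordered semirings with `IsRCA` -/

/-- The models of `RCA₀`. -/
class ModelsRCA (M : Model.{u}) : Prop where
  satisfies : ∀ ψ ∈ RCA₀, M.Satisfies ψ

section Bridge

variable (M : Model.{u}) [hM : ModelsRCA M]

/-- The axioms are sentences, so one assignment suffices. Satisfaction unfolds by definition, which
lets the instances below use these facts directly as algebraic laws. -/
theorem Model.realize_basicAxioms (i : ℕ) (hi : i < basicAxioms.length := by decide) :
    (basicAxioms[i] 0).Realize M (fun _ => M.zero) (fun _ => ⟨_, M.sets_nonempty.some_mem⟩) :=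
  ModelsRCA.satisfies (basicAxioms[i] 0) (Or.inl (Or.inl ⟨_, List.getElem_mem hi, rfl⟩)) _ _

instance : Zero M.carrier := ⟨M.zero⟩
instance : One M.carrier := ⟨M.one⟩
instance : Add M.carrier := ⟨M.add⟩
instance : Mul M.carrier := ⟨M.mul⟩
instance : LT M.carrier := ⟨M.lt⟩
-- This has the shape of the formula `le`, so that axioms stated with `le` unfold to statements
-- about `≤`.
instance : LE M.carrier := ⟨fun x y => M.lt x y ∨ x = y⟩

instance : CommSemiring M.carrier :=
  have add_comm' : ∀ x y : M.carrier, x + y = y + x := M.realize_basicAxioms 1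
  have mul_comm' : ∀ x y : M.carrier, x * y = y * x := M.realize_basicAxioms 3
  have distrib' : ∀ x y z : M.carrier, x * (y + z) = x * y + x * z := M.realize_basicAxioms 4
  have add_zero' : ∀ x : M.carrier, x + 0 = x := M.realize_basicAxioms 5
  have mul_zero' : ∀ x : M.carrier, x * 0 = 0 := M.realize_basicAxioms 6
  have mul_one' : ∀ x : M.carrier, x * 1 = x := M.realize_basicAxioms 7
  { nsmul := nsmulRec
    add_assoc := M.realize_basicAxioms 0
    add_comm := add_comm'
    mul_assoc := M.realize_basicAxioms 2
    mul_comm := mul_comm'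
    left_distrib := distrib'
    right_distrib := fun x y z => by rw [mul_comm', distrib', mul_comm' z, mul_comm' z]
    add_zero := add_zero'
    zero_add := fun x => (add_comm' _ _).trans (add_zero' x)
    mul_zero := mul_zero'
    zero_mul := fun x => (mul_comm' _ _).trans (mul_zero' x)
    mul_one := mul_one'
    one_mul := fun x => (mul_comm' _ _).trans (mul_one' x) }

open Classical in
noncomputable instance : LinearOrder M.carrier :=
  have lt_trans' : ∀ x y z : M.carrier, x < y ∧ y < z → x < z := M.realize_basicAxioms 8
  have lt_irrefl' : ∀ x : M.carrier, ¬ x < x := M.realize_basicAxioms 9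
  have trich' : ∀ x y : M.carrier, x < y ∨ x = y ∨ y < x := M.realize_basicAxioms 10
  { le_refl := fun x => Or.inr rfl
    le_trans := by
      rintro x y z (h1 | rfl) (h2 | rfl)
      · exact Or.inl (lt_trans' _ _ _ ⟨h1, h2⟩)
      · exact Or.inl h1
      · exact Or.inl h2
      · exact Or.inr rfl
    lt_iff_le_not_ge := by
      intro x y
      constructor
      · intro h
        refine ⟨Or.inl h, ?_⟩
        rintro (h' | rfl)
        · exact lt_irrefl' _ (lt_trans' _ _ _ ⟨h, h'⟩)
        · exact lt_irrefl' _ h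
      · rintro ⟨h | rfl, h'⟩
        · exact h
        · exact absurd (Or.inr rfl) h'
    le_antisymm := by
      rintro x y (h | h) (h' | h')
      · exact absurd (lt_trans' _ _ _ ⟨h, h'⟩) (lt_irrefl' _)
      · exact h'.symm
      · exact h
      · exact h
    le_total := fun x y => by
      rcases trich' x y with h | h | h
      · exact Or.inl (Or.inl h)
      · exact Or.inl (Or.inr h)
      · exact Or.inr (Or.inl h)
    toDecidableLE := fun _ _ => Classical.propDecidable _ }

noncomputable instance : DiscreteSemiring M.carrier :=
  have add_lt' : ∀ x y z : M.carrier, x < y → x + z < y + z := M.realize_basicAxioms 11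
  have mul_lt' : ∀ x y z : M.carrier, 0 < z ∧ x < y → x * z < y * z := M.realize_basicAxioms 12
  have sub' : ∀ x y : M.carrier, x < y → ∃ z, x + z = y := M.realize_basicAxioms 13
  have zero_lt' : (0 : M.carrier) < 1 := M.realize_basicAxioms 14
  have zero_le' : ∀ x : M.carrier, 0 ≤ x := M.realize_basicAxioms 16
  have add_le' : ∀ x y : M.carrier, x ≤ y → ∀ z, x + z ≤ y + z := fun x y h z => by
    rcases h with h | rfl
    · exact Or.inl (add_lt' _ _ _ h)
    · exact le_rfl
  { (inferInstance : CommSemiring M.carrier), (inferInstance : LinearOrder M.carrier) with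
    one_le_of_pos := M.realize_basicAxioms 15
    add_le_add_left := add_le'
    le_of_add_le_add_left := fun x y z h => by
      by_contra hc
      have := add_lt' _ _ x (not_le.1 hc)
      rw [add_comm z, add_comm y] at this
      exact absurd h (not_le.2 this)
    zero_le_one := zero_lt'.le
    exists_pair_ne := ⟨0, 1, zero_lt'.ne⟩
    mul_lt_mul_of_pos_left := fun x hx y z h => by
      simpa only [mul_comm x] using mul_lt' _ _ _ ⟨hx, h⟩
    mul_lt_mul_of_pos_right := fun x hx y z h => mul_lt' _ _ _ ⟨hx, h⟩
    exists_add_of_le := by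
      rintro x y (h | rfl)
      · obtain ⟨z, hz⟩ := sub' _ _ h
        exact ⟨z, hz.symm⟩
      · exact ⟨0, (add_zero _).symm⟩
    le_add_self := fun x y => by simpa using add_le' 0 y (zero_le' y) x
    le_self_add := fun x y => by simpa [add_comm] using add_le' 0 y (zero_le' y) x }

/-- The assignment giving the even variables the values `v` and drawing all other values from
`c`. -/
def merge {N : Type u} {n : ℕ} (v : Fin n → N) (c : ℕ → N) : ℕ → N :=
  fun x => if h : x / 2 < n ∧ x % 2 = 0 then v ⟨x / 2, h.1⟩ else c (x / 2)

theorem merge_even {N : Type u} {n : ℕ} (v : Fin n → N) (c : ℕ → N) (i : Fin n) :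
    merge v c (2 * i) = v i := by
  have h : 2 * (i : ℕ) / 2 < n ∧ 2 * (i : ℕ) % 2 = 0 := by omega
  rw [merge, dif_pos h]
  congr 1
  ext
  simp

theorem merge_odd {N : Type u} {n : ℕ} (v : Fin n → N) (c : ℕ → N) (j : ℕ) :
    merge v c (2 * j + 1) = c j := by
  have h : ¬ ((2 * j + 1) / 2 < n ∧ (2 * j + 1) % 2 = 0) := by omega
  rw [merge, dif_neg h]
  congr 1
  omega

/-- Even variables hold arguments and odd ones parameters, so binding the variable `2 * n` appends
one argument without disturbing any parameter in use. -/
theorem update_merge {N : Type u} {n : ℕ} (v : Fin n → N) (c : ℕ → N) (a : N) :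
    Function.update (merge v c) (2 * n) a = merge (Fin.snoc v a : Fin (n + 1) → N) c := by
  funext x
  by_cases hx : x = 2 * n
  · subst hx
    rw [Function.update_self]
    have := merge_even (Fin.snoc v a : Fin (n + 1) → N) c (Fin.last n)
    rw [Fin.snoc_last] at this
    exact this.symm
  · rw [Function.update_of_ne hx]
    by_cases h : x / 2 < n ∧ x % 2 = 0
    · have h' : x / 2 < n + 1 ∧ x % 2 = 0 := ⟨by omega, h.2⟩
      rw [merge, merge, dif_pos h, dif_pos h']
      have := Fin.snoc_castSucc (α := fun _ => N) a v ⟨x / 2, h.1⟩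
      exact this.symm
    · have h' : ¬ (x / 2 < n + 1 ∧ x % 2 = 0) := by omega
      rw [merge, merge, dif_neg h, dif_neg h']

variable {M}

/-- The term avoids `2 * n` in order to serve as the bound of a quantifier over that variable.
Parameters need only lie in the range of `c`, so one `c` serves several polynomials. -/
theorem Poly.exists_term {n : ℕ} {p : (Fin n → M.carrier) → M.carrier} (hp : Poly p) :
    ∃ C : Set M.carrier, C.Countable ∧ ∀ c : ℕ → M.carrier, C ⊆ Set.range c →
      ∃ t : Term, 2 * n ∉ t.vars ∧ ∀ v, t.val M (merge v c) = p v := by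
  induction hp with
  | var i =>
    refine ⟨∅, Set.countable_empty, fun c _ => ⟨.var (2 * i), ?_, fun v => merge_even v c i⟩⟩
    simp only [Term.vars, Set.mem_singleton_iff]
    omega
  | const a =>
    refine ⟨{a}, Set.countable_singleton a, fun c hc => ?_⟩
    obtain ⟨j, hj⟩ := hc rfl
    refine ⟨.var (2 * j + 1), ?_, fun v => (merge_odd v c j).trans hj⟩
    simp only [Term.vars, Set.mem_singleton_iff]
    omega
  | add _ _ h1 h2 =>
    obtain ⟨C, hC, h1⟩ := h1
    obtain ⟨D, hD, h2⟩ := h2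
    refine ⟨C ∪ D, hC.union hD, fun c hc => ?_⟩
    obtain ⟨s, hs, hs'⟩ := h1 c (Set.subset_union_left.trans hc)
    obtain ⟨t, ht, ht'⟩ := h2 c (Set.subset_union_right.trans hc)
    exact ⟨.add s t, fun h => h.elim hs ht, fun v => congrArg₂ M.add (hs' v) (ht' v)⟩
  | mul _ _ h1 h2 =>
    obtain ⟨C, hC, h1⟩ := h1
    obtain ⟨D, hD, h2⟩ := h2
    refine ⟨C ∪ D, hC.union hD, fun c hc => ?_⟩
    obtain ⟨s, hs, hs'⟩ := h1 c (Set.subset_union_left.trans hc)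
    obtain ⟨t, ht, ht'⟩ := h2 c (Set.subset_union_right.trans hc)
    exact ⟨.mul s t, fun h => h.elim hs ht, fun v => congrArg₂ M.mul (hs' v) (ht' v)⟩

/-- Every relation in `Delta0` is defined by a bounded formula, provided that the assignments
provide the finitely many parameters. -/
theorem Delta0.exists_formula {n : ℕ} {P : (Fin n → M.carrier) → Prop} (hP : Delta0 M.sets P) :
    ∃ C : Set M.carrier, C.Countable ∧ ∃ D : Set M.sets, D.Countable ∧
      ∀ (c : ℕ → M.carrier) (E : ℕ → M.sets), C ⊆ Set.range c → D ⊆ Set.range E →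
        ∃ φ, IsBounded φ ∧ ∀ v, φ.Realize M (merge v c) E ↔ P v := by
  induction hP with
  | eq hs ht =>
    obtain ⟨C, hC, h1⟩ := hs.exists_term
    obtain ⟨D, hD, h2⟩ := ht.exists_term
    refine ⟨C ∪ D, hC.union hD, ∅, Set.countable_empty, fun c E hc _ => ?_⟩
    obtain ⟨s, -, hs⟩ := h1 c (Set.subset_union_left.trans hc)
    obtain ⟨t, -, ht⟩ := h2 c (Set.subset_union_right.trans hc)
    exact ⟨.eq s t, .eq s t, fun v => by rw [Formula.Realize, hs, ht]⟩
  | lt hs ht =>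
    obtain ⟨C, hC, h1⟩ := hs.exists_term
    obtain ⟨D, hD, h2⟩ := ht.exists_term
    refine ⟨C ∪ D, hC.union hD, ∅, Set.countable_empty, fun c E hc _ => ?_⟩
    obtain ⟨s, -, hs⟩ := h1 c (Set.subset_union_left.trans hc)
    obtain ⟨t, -, ht⟩ := h2 c (Set.subset_union_right.trans hc)
    exact ⟨.lt s t, .lt s t, fun v => by rw [Formula.Realize, hs, ht]; rfl⟩
  | @mem n p Z hs hZ =>
    obtain ⟨C, hC, h1⟩ := hs.exists_term
    refine ⟨C, hC, {⟨Z, hZ⟩}, Set.countable_singleton _, fun c E hc hE => ?_⟩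
    obtain ⟨s, -, hs⟩ := h1 c hc
    obtain ⟨X, hX⟩ := hE rfl
    exact ⟨.mem s X, .mem s X, fun v => by rw [Formula.Realize, hs, hX]⟩
  | neg _ ih =>
    obtain ⟨C, hC, D, hD, ih⟩ := ih
    refine ⟨C, hC, D, hD, fun c E hc hE => ?_⟩
    obtain ⟨φ, hφ, h⟩ := ih c E hc hE
    exact ⟨.neg φ, .neg hφ, fun v => not_congr (h v)⟩
  | and _ _ h1 h2 =>
    obtain ⟨C, hC, D, hD, h1⟩ := h1
    obtain ⟨C', hC', D', hD', h2⟩ := h2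
    refine ⟨C ∪ C', hC.union hC', D ∪ D', hD.union hD', fun c E hc hE => ?_⟩
    obtain ⟨φ, hφ, h1⟩ := h1 c E (Set.subset_union_left.trans hc)
      (Set.subset_union_left.trans hE)
    obtain ⟨ψ, hψ, h2⟩ := h2 c E (Set.subset_union_right.trans hc)
      (Set.subset_union_right.trans hE)
    exact ⟨.and φ ψ, .and hφ hψ, fun v => and_congr (h1 v) (h2 v)⟩
  | @bex n p P ht _ ih =>
    obtain ⟨C, hC, h1⟩ := ht.exists_term
    obtain ⟨C', hC', D, hD, h2⟩ := ih
    refine ⟨C ∪ C', hC.union hC', D, hD, fun c E hc hE => ?_⟩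
    obtain ⟨t, htn, ht⟩ := h1 c (Set.subset_union_left.trans hc)
    obtain ⟨φ, hφ, h2⟩ := h2 c E (Set.subset_union_right.trans hc) hE
    refine ⟨.ex₁ (2 * n) (.and (.lt (.var (2 * n)) t) φ), .ex htn hφ, fun v => ?_⟩
    refine exists_congr fun a => and_congr ?_ ?_
    · have h3 : t.val M (Function.update (merge v c) (2 * n) a) = p v := by
        rw [← ht v]
        refine t.val_congr fun x hx => Function.update_of_ne ?_ _ _
        rintro rfl; exact htn hx
      rw [Formula.Realize, h3, Term.val, Function.update_self]
      rfl
    · rw [update_merge, h2]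
      simp only [Fin.snoc_castSucc, Fin.snoc_last]

theorem update_update_merge {N : Type u} (c : ℕ → N) (x a : N) :
    Function.update (Function.update (merge (Fin.elim0 : Fin 0 → N) c) 0 x) 2 a =
      merge ![x, a] c := by
  have h := update_merge (Fin.elim0 : Fin 0 → N) c x
  have h' : Function.update (merge (Fin.snoc Fin.elim0 x : Fin 1 → N) c) 2 a = _ :=
    update_merge (Fin.snoc Fin.elim0 x : Fin 1 → N) c a
  rw [mul_zero] at h
  rw [h, h']
  congr 1
  funext i
  fin_cases i <;> rfl

theorem exists_subset_range {α : Type*} {C : Set α} (hC : C.Countable) (a : α) :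
    ∃ c : ℕ → α, C ⊆ Set.range c := by
  obtain ⟨c, hc⟩ := (hC.insert a).exists_eq_range (Set.insert_nonempty a C)
  exact ⟨c, hc ▸ Set.subset_insert a C⟩

variable (M)

/-- The matrix becomes a bounded formula in the variables `0` and `2`; quantifying `2` gives a `Σ⁰₁`
or `Π⁰₁` formula in `0`, to which the axioms apply. In comprehension both matrices are realized
under one common assignment. -/
theorem Model.isRCA : IsRCA M.sets where
  sigma_induction := by
    intro P hP h0 hstep
    obtain ⟨C, hC, D, hD, h⟩ := hP.exists_formula
    obtain ⟨c, hc⟩ := exists_subset_range hC M.zero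
    obtain ⟨E, hE⟩ := exists_subset_range hD ⟨_, M.sets_nonempty.some_mem⟩
    obtain ⟨θ, hθ, h⟩ := h c E hc hE
    set e : ℕ → M.carrier := merge (Fin.elim0 : Fin 0 → M.carrier) c with he
    have hφ : ∀ x, (Formula.ex₁ 2 θ).Realize M (Function.update e 0 x) E ↔ ∃ a, P x a := by
      intro x
      refine exists_congr fun a => ?_
      rw [he, update_update_merge, h]
      rfl
    obtain ⟨m, hm⟩ := (((Formula.ex₁ 2 θ).finite_freeNum.insert 0)).exists_notMem
    have hm0 : m ≠ 0 := fun h => hm (Or.inl h)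
    have hm1 : m ∉ (Formula.ex₁ 2 θ).freeNum := fun h => hm (Or.inr h)
    have ind := ModelsRCA.satisfies (M := M) (inductionAxiom (.ex₁ 2 θ) 0 m)
      (Or.inl (Or.inr ⟨_, 0, m, ⟨2, θ, hθ, rfl⟩, hm0, hm1, rfl⟩)) e E
    intro x
    rw [← hφ]
    refine ind ⟨?_, fun x hx => ?_⟩ x
    · rw [Formula.realize_inst hm1 hm0 _ _ fun _ => rfl]
      exact (hφ _).2 h0
    · rw [Formula.realize_inst hm1 hm0 _ _ fun a => ?_, Function.update_idem]
      · have := (hφ _).2 (hstep x ((hφ x).1 hx))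
        convert this using 2
        change M.add (Function.update e 0 x 0) M.one = _
        rw [Function.update_self]
        rfl
      · change M.add (Function.update (Function.update e 0 x) m a 0) M.one = _
        rw [Function.update_of_ne hm0.symm]
        rfl
  comprehension := by
    intro P Q hP hQ hPQ
    obtain ⟨C, hC, D, hD, h⟩ := hP.exists_formula
    obtain ⟨C', hC', D', hD', h'⟩ := hQ.exists_formula
    obtain ⟨c, hc⟩ := exists_subset_range (hC.union hC') M.zero
    obtain ⟨E, hE⟩ := exists_subset_range (hD.union hD') ⟨_, M.sets_nonempty.some_mem⟩
    obtain ⟨θ, hθ, h⟩ := h c E (Set.subset_union_left.trans hc) (Set.subset_union_left.trans hE)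
    obtain ⟨η, hη, h'⟩ :=
      h' c E (Set.subset_union_right.trans hc) (Set.subset_union_right.trans hE)
    set e : ℕ → M.carrier := merge (Fin.elim0 : Fin 0 → M.carrier) c with he
    have hφ : ∀ x, (Formula.ex₁ 2 θ).Realize M (Function.update e 0 x) E ↔ ∃ a, P x a := by
      intro x
      refine exists_congr fun a => ?_
      rw [he, update_update_merge, h]
      rfl
    have hψ : ∀ x, (Formula.all₁ 2 η).Realize M (Function.update e 0 x) E ↔ ∀ a, Q x a := by
      intro x
      refine forall_congr' fun a => ?_
      rw [he, update_update_merge, h']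
      rfl
    obtain ⟨X, hX⟩ := (Formula.ex₁ 2 θ).finite_freeSet.exists_notMem
    obtain ⟨Y, hY⟩ := ModelsRCA.satisfies (M := M) (comprehensionAxiom (.ex₁ 2 θ) (.all₁ 2 η) 0 X)
      (Or.inr ⟨_, _, 0, X, ⟨2, θ, hθ, rfl⟩, ⟨2, η, hη, rfl⟩, hX, rfl⟩) e E
      fun x => (hφ x).trans ((hPQ x).trans (hψ x).symm)
    have hYset : {x | ∃ a, P x a} = (Y : Set M.carrier) := by
      ext x
      have h1 := hY x
      have h2 : (Formula.ex₁ 2 θ).Realize M (Function.update e 0 x) (Function.update E X Y) ↔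
          (Formula.ex₁ 2 θ).Realize M (Function.update e 0 x) E :=
        Formula.realize_congr _ (fun _ _ => rfl) fun Z hZ => Function.update_of_ne
          (by rintro rfl; exact hX hZ) _ _
      have h3 : (Function.update e 0 x 0 ∈ (Function.update E X Y X : Set M.carrier)) ↔ _ :=
        h1.trans (h2.trans (hφ x))
      rw [Function.update_self, Function.update_self] at h3
      exact h3.symm
    rw [hYset]
    exact Y.2

end Bridge

/-! ### The notions of the theorem as predicates on a structure -/

section Society

variable {N : Type u} [DiscreteSemiring N]

def IsFunction (G D C : N → Prop) : Prop :=
  (∀ c, G c → ∃ y z, c = pr y z ∧ D y ∧ C z) ∧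
  (∀ y, D y → ∃ z, G (pr y z) ∧ ∀ z', G (pr y z') → z' = z)

def IsSeq (s l : N) : Prop :=
  IsFinSetCode s ∧ IsFunction (fun c => InCode c s) (fun i => i < l) fun _ => (0 : N) = 0

def IsAlgebra (V A : Set N) : Prop :=
  (∀ i v, pr i v ∈ A → v ∈ V) ∧
  (∃ i, ∀ v, pr i v ∈ A ↔ v ∈ V) ∧
  (∀ i j, ∃ k, ∀ v, pr k v ∈ A ↔ pr i v ∈ A ∨ pr j v ∈ A) ∧
  (∀ i j, ∃ k, ∀ v, pr k v ∈ A ↔ pr i v ∈ A ∧ pr j v ∈ A) ∧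
  (∀ i, ∃ k, ∀ v, pr k v ∈ A ↔ v ∈ V ∧ ¬ pr i v ∈ A)

def IsSingleton (A : Set N) (k d : N) : Prop := ∀ v, pr k v ∈ A ↔ v = d

def IsAtomic (V A : Set N) : Prop := ∀ v, v ∈ V → ∃ k, IsSingleton A k v

def IsUltrafilter (V A U : Set N) : Prop :=
  (∀ i, (∀ v, pr i v ∈ A ↔ v ∈ V) → i ∈ U) ∧
  (∀ i, (∀ v, ¬ pr i v ∈ A) → ¬ i ∈ U) ∧
  (∀ i j, (i ∈ U ∧ ∀ v, pr i v ∈ A → pr j v ∈ A) → j ∈ U) ∧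
  (∀ i j k, (i ∈ U ∧ j ∈ U ∧ ∀ v, pr k v ∈ A ↔ pr i v ∈ A ∧ pr j v ∈ A) → k ∈ U) ∧
  (∀ i j, (∀ v, pr j v ∈ A ↔ v ∈ V ∧ ¬ pr i v ∈ A) → i ∈ U ∨ j ∈ U)

def IsPrincipal (A U : Set N) : Prop := ∃ k d, k ∈ U ∧ IsSingleton A k d

def LeR (R x y : N) : Prop := InCode (pr x y) R

def LtR (R x y : N) : Prop := LeR R x y ∧ ¬ LeR R y x

def IsWeakOrder (X : Set N) (R : N) : Prop :=
  IsFinSetCode R ∧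
  (∀ c, InCode c R → ∃ x, x ∈ X ∧ ∃ y, y ∈ X ∧ c = pr x y) ∧
  (∀ x, x ∈ X → ∀ y, y ∈ X → LeR R x y ∨ LeR R y x) ∧
  (∀ x, x ∈ X → ∀ y, y ∈ X → ∀ z, z ∈ X → LeR R x y ∧ LeR R y z → LeR R x z)

def IsProfileSeq (V X F : Set N) : Prop :=
  ∀ i, IsFunction (fun c => pr i c ∈ F) (fun v => v ∈ V) (IsWeakOrder X)

def LeP (F : Set N) (i v x y : N) : Prop := ∃ R, pr i (pr v R) ∈ F ∧ LeR R x y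

def LtP (F : Set N) (i v x y : N) : Prop := ∃ R, pr i (pr v R) ∈ F ∧ LtR R x y

def IsUniformlyMeasurable (S : Set (Set N)) (V X A F : Set N) : Prop :=
  ∃ μ : S,
    IsFunction (fun c => c ∈ (μ : Set N))
      (fun t => ∃ n x, x ∈ X ∧ ∃ y, y ∈ X ∧ t = pr (pr n x) y) (fun _ => (0 : N) = 0) ∧
    ∀ n x, x ∈ X → ∀ y, y ∈ X → ∀ v, v ∈ V →
      (LeP F n v x y ↔ ∃ k, pr (pr (pr n x) y) k ∈ (μ : Set N) ∧ pr k v ∈ A)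

def Entry (s i j : N) : Prop := InCode (pr i j) s

def IsPerm (X : Set N) (p l : N) : Prop :=
  IsSeq p l ∧
  (∀ i R, Entry p i R → IsWeakOrder X R) ∧
  (∀ R, IsWeakOrder X R → ∃ i, Entry p i R ∧ ∀ j, Entry p j R → j = i)

def IsQPart (k s l : N) : Prop := IsSeq s l ∧ 1 ≤ l ∧ l ≤ k

/-- `i < l - 1` and `v` belongs to the coalition with index `s(i)`. -/
def Hit (A : Set N) (s l v i : N) : Prop := i + 1 < l ∧ ∃ a, Entry s i a ∧ pr a v ∈ A

def IsQPEmbedded (S : Set (Set N)) (V X A F : Set N) : Prop :=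
  ∃ e : S,
    IsFunction (fun c => c ∈ (e : Set N))
      (fun t => ∃ p s k l, IsPerm X p k ∧ IsQPart k s l ∧ t = pr p s) (fun _ => (0 : N) = 0) ∧
    ∀ p s k l n, (IsPerm X p k ∧ IsQPart k s l ∧ pr (pr p s) n ∈ (e : Set N)) →
      ∀ v, v ∈ V → ∀ R, pr n (pr v R) ∈ F →
        (∀ i, (Hit A s l v i ∧ ∀ j, Hit A s l v j → j = i) → Entry p i R) ∧
        ((¬ ∃ i, Hit A s l v i ∧ ∀ j, Hit A s l v j → j = i) → ∃ j, j + 1 = l ∧ Entry p j R)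

def IsSociety (S : Set (Set N)) (V X A F : Set N) : Prop :=
  (∃ v, v ∈ V) ∧ (∃ b, ∀ x, x ∈ X → x < b) ∧
  (∃ x, x ∈ X ∧ ∃ y, y ∈ X ∧ ∃ z, z ∈ X ∧ ¬ x = y ∧ ¬ x = z ∧ ¬ y = z) ∧
  IsAlgebra V A ∧ IsAtomic V A ∧ IsProfileSeq V X F ∧
  IsUniformlyMeasurable S V X A F ∧ IsQPEmbedded S V X A F

def LeS (σ : Set N) (i x y : N) : Prop := ∃ R, pr i R ∈ σ ∧ LeR R x y

def LtS (σ : Set N) (i x y : N) : Prop := ∃ R, pr i R ∈ σ ∧ LtR R x y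

def AgreeP (V F : Set N) (i j x y : N) : Prop :=
  ∀ v, v ∈ V → ∀ a b, ((a = x ∨ a = y) ∧ (b = x ∨ b = y)) → (LeP F i v a b ↔ LeP F j v a b)

def AgreeS (σ : Set N) (i j x y : N) : Prop :=
  ∀ a b, ((a = x ∨ a = y) ∧ (b = x ∨ b = y)) → (LeS σ i a b ↔ LeS σ j a b)

def IsSWF (V X F σ : Set N) : Prop :=
  IsFunction (fun c => c ∈ σ) (fun _ => (0 : N) = 0) (IsWeakOrder X) ∧
  (∀ x, x ∈ X → ∀ y, y ∈ X → ∀ i, (∀ v, v ∈ V → LtP F i v x y) → LtS σ i x y) ∧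
  (∀ x, x ∈ X → ∀ y, y ∈ X → ∀ i j, AgreeP V F i j x y → AgreeS σ i j x y)

def IsDecisive (X A F σ : Set N) (n : N) : Prop :=
  ∀ x, x ∈ X → ∀ y, y ∈ X → ∀ i, (∀ v, pr n v ∈ A → LtP F i v x y) → LtS σ i x y

def HasCofiniteCoalitions (V X F σ : Set N) : Prop :=
  ∀ j x, x ∈ X → ∀ y, y ∈ X → (∃ k, ∀ v, v ∈ V → k ≤ v → LtP F j v x y) → LtS σ j x y

section Bridge

variable (M : Model.{u}) [ModelsRCA M]

/-- The predicates above mirror the formulas connective by connective, down to the trivial condition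
`0 = 0`, so satisfaction of the sentence unfolds to the hypothesis by definition. -/
theorem Model.satisfies_converseKS (h : ∀ V X A F U : M.sets,
    IsSociety M.sets (V : Set M.carrier) X A F ∧ IsUltrafilter (V : Set M.carrier) A U →
      ∃ σ : M.sets, IsSWF (V : Set M.carrier) X F σ ∧
        (∀ i, i ∈ (U : Set M.carrier) ↔ IsDecisive (X : Set M.carrier) A F σ i) ∧
        (¬ IsPrincipal (A : Set M.carrier) U ↔
          HasCofiniteCoalitions (V : Set M.carrier) X F σ)) :
    M.Satisfies converseKS := fun _ _ => h

end Bridge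

end Society

/-! ### Ultrafilters on countable algebras -/

section Ultrafilter

variable {N : Type u} [DiscreteSemiring N] {V A U : Set N}

theorem exists_compl_index (hA : IsAlgebra V A) (hU : IsUltrafilter V A U) (i : N) :
    ∃ j, (∀ v, pr j v ∈ A ↔ v ∈ V ∧ ¬ pr i v ∈ A) ∧ (i ∈ U ∨ j ∈ U) := by
  obtain ⟨j, hj⟩ := hA.2.2.2.2 i
  exact ⟨j, hj, hU.2.2.2.2 i j hj⟩

theorem IsUltrafilter.mem_of_inter_subset (hA : IsAlgebra V A) (hU : IsUltrafilter V A U)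
    {i j k : N} (hi : i ∈ U) (hj : j ∈ U) (h : ∀ v, pr i v ∈ A → pr j v ∈ A → pr k v ∈ A) :
    k ∈ U := by
  obtain ⟨l, hl⟩ := hA.2.2.2.1 i j
  have hlU : l ∈ U := hU.2.2.2.1 i j l ⟨hi, hj, hl⟩
  exact hU.2.2.1 l k ⟨hlU, fun v hv => h v ((hl v).1 hv).1 ((hl v).1 hv).2⟩

theorem IsUltrafilter.exists_mem_inter (hA : IsAlgebra V A) (hU : IsUltrafilter V A U)
    {i j : N} (hi : i ∈ U) (hj : j ∈ U) : ∃ v, v ∈ V ∧ pr i v ∈ A ∧ pr j v ∈ A := by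
  obtain ⟨l, hl⟩ := hA.2.2.2.1 i j
  have hlU : l ∈ U := hU.2.2.2.1 i j l ⟨hi, hj, hl⟩
  by_contra hc
  push Not at hc
  refine hU.2.1 l (fun v hv => ?_) hlU
  obtain ⟨h1, h2⟩ := (hl v).1 hv
  exact hc v (hA.1 _ _ h1) h1 h2

/-- If `A_i` is not in the ultrafilter, its complement is, and that complement is contained in
`A_j`. This is the source of totality of the social preference. -/
theorem IsUltrafilter.mem_or_mem (hA : IsAlgebra V A) (hU : IsUltrafilter V A U) {i j : N}
    (h : ∀ v, v ∈ V → pr i v ∈ A ∨ pr j v ∈ A) : i ∈ U ∨ j ∈ U := by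
  obtain ⟨k, hk, hiU | hkU⟩ := exists_compl_index hA hU i
  · exact Or.inl hiU
  · refine Or.inr (hU.2.2.1 k j ⟨hkU, fun v hv => ?_⟩)
    obtain ⟨h1, h2⟩ := (hk v).1 hv
    exact (h v h1).resolve_left h2

/-- A nonprincipal ultrafilter contains, for every `k`, a coalition without elements below `k`. -/
theorem IsUltrafilter.exists_mem_avoiding {S : Set (Set N)} (hS : IsRCA S) (hAS : A ∈ S)
    (hUS : U ∈ S) (hA : IsAlgebra V A) (hat : IsAtomic V A) (hU : IsUltrafilter V A U)
    (hne : ∃ i, i ∈ U) (hnp : ¬ IsPrincipal A U) (k : N) :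
    ∃ m, m ∈ U ∧ ∀ d, d < k → ¬ pr m d ∈ A := by
  refine hS.sigma_induction (fun k m => m ∈ U ∧ ∀ d, d < k → ¬ pr m d ∈ A) ?_ ?_ ?_ k
  · exact .and (.mem (Poly.var _) hUS) <| .ball (Poly.var _) <|
      .neg <| .mem ((Poly.var _).pr (Poly.var _)) hAS
  · obtain ⟨i, hi⟩ := hne
    exact ⟨i, hi, fun d hd => absurd hd not_lt_zero⟩
  · rintro x ⟨m, hm, h⟩
    by_cases hx : x ∈ V
    · obtain ⟨s, hs⟩ := hat x hx
      -- By atomicity `{x}` is a coalition; as `U` is non-principal, its complement is in `U`, and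
      -- intersecting with it removes `x`.
      obtain ⟨j, hj, hsU | hjU⟩ := exists_compl_index hA hU s
      · exact absurd ⟨s, x, hsU, hs⟩ hnp
      · obtain ⟨l, hl⟩ := hA.2.2.2.1 m j
        refine ⟨l, hU.2.2.2.1 m j l ⟨hm, hjU, hl⟩, fun d hd hld => ?_⟩
        obtain ⟨h1, h2⟩ := (hl d).1 hld
        rcases eq_or_lt_of_le (lt_add_one_iff_le.1 hd) with rfl | hlt
        · exact ((hj d).1 h2).2 ((hs d).2 rfl)
        · exact h d hlt h1
    · refine ⟨m, hm, fun d hd hmd => ?_⟩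
      rcases eq_or_lt_of_le (lt_add_one_iff_le.1 hd) with rfl | hlt
      · exact hx (hA.1 _ _ hmd)
      · exact h d hlt hmd

end Ultrafilter

/-! ### Weak orders on `X`: codes, a common bound, and permutations of `W` -/

section WeakOrders

variable {N : Type u} [DiscreteSemiring N] {S : Set (Set N)} {X : Set N} {b : N}

/-- Since `X` is bounded by `b`, every quantifier in the definition can be bounded. -/
theorem setOf_isWeakOrder_mem (hS : IsRCA S) (hX : X ∈ S) (hb : ∀ x, x ∈ X → x < b) :
    {R | IsWeakOrder X R} ∈ S := by
  have hallX : ∀ {n : ℕ} {P : (Fin n → N) → N → Prop},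
      Delta0 S (fun w : Fin (n + 1) → N => P (fun i => w i.castSucc) (w (Fin.last n))) →
      Delta0 S fun v => ∀ x, x ∈ X → P v x := fun {n P} h =>
    .all_of_le (P := fun v x => x ∈ X → P v x) (fun _ => b) (Poly.const b)
      (fun v x hx => (hb x (Classical.not_imp.1 hx).1).le) (.imp (.mem (Poly.var _) hX) h)
  have hle : ∀ {n : ℕ} (i j k : Fin n), Delta0 S fun v => LeR (v i) (v j) (v k) := fun i j k =>
    .inCode ((Poly.var _).pr (Poly.var _)) (Poly.var _)
  refine hS.setOf_mem (.and (.isFinSetCode (Poly.var _)) <| .and ?_ <| .and ?_ ?_)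
  · refine .all_of_le (fun v => v 0) (Poly.var 0) ?_ <|
      .imp (.inCode (Poly.var _) (Poly.var _)) <|
      .ex_of_le (fun _ => b) (Poly.const b) ?_ <| .and (.mem (Poly.var _) hX) <|
      .ex_of_le (fun _ => b) (Poly.const b) ?_ <| .and (.mem (Poly.var _) hX) <|
      .eq (Poly.var _) ((Poly.var _).pr (Poly.var _))
    · intro v c hc
      exact (Classical.not_imp.1 hc).1.lt.le
    · rintro v x ⟨hx, -⟩
      exact (hb x hx).le
    · rintro v x ⟨hx, -⟩
      exact (hb x hx).le
  · exact hallX <| hallX <| .or (hle _ _ _) (hle _ _ _)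
  · exact hallX <| hallX <| hallX <| .imp (.and (hle _ _ _) (hle _ _ _)) (hle _ _ _)

theorem setOf_inCode_mem (hS : IsRCA S) (c : N) : {i | InCode i c} ∈ S :=
  hS.setOf_mem (.inCode (Poly.var _) (Poly.const c))

theorem IsWeakOrder.ext {R R' : N} (hR : IsWeakOrder X R) (hR' : IsWeakOrder X R')
    (h : ∀ x, x ∈ X → ∀ y, y ∈ X → (LeR R x y ↔ LeR R' x y)) : R = R' := by
  refine hR.1.ext hR'.1 fun c => ⟨fun hc => ?_, fun hc => ?_⟩
  · obtain ⟨x, hx, y, hy, rfl⟩ := hR.2.1 c hc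
    exact (h x hx y hy).1 hc
  · obtain ⟨x, hx, y, hy, rfl⟩ := hR'.2.1 c hc
    exact (h x hx y hy).2 hc

/-- All weak orders on `X` are sets of pairs below the fixed number `pr b b + 1`, so the uniform
bound on codes applies. -/
theorem exists_isWeakOrder_bound (hS : IsRCA S) (hb : ∀ x, x ∈ X → x < b) :
    ∃ B, ∀ R, IsWeakOrder X R → R < B := by
  obtain ⟨B, hB⟩ := hS.exists_code_bound (pr b b + 1)
  refine ⟨B, fun R hR => ?_⟩
  obtain ⟨c, hc, hc1, hc2⟩ := hB _ (setOf_inCode_mem hS R) (by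
    intro i hi
    obtain ⟨x, hx, y, hy, rfl⟩ := hR.2.1 i hi
    exact lt_add_one_iff_le.2 (pr_mono (hb x hx).le (hb y hy).le))
  rwa [hR.1.ext hc1 fun i => (hc2 i).symm]

/-- Every definable weak order on `X` has a code. -/
theorem exists_isWeakOrder (hS : IsRCA S) (hX : X ∈ S) (hb : ∀ x, x ∈ X → x < b)
    {r : N → N → Prop} (hr : Delta0 S fun v : Fin 4 → N => r (v 2) (v 3))
    (htotal : ∀ x, x ∈ X → ∀ y, y ∈ X → r x y ∨ r y x)
    (htrans : ∀ x, x ∈ X → ∀ y, y ∈ X → ∀ z, z ∈ X → r x y → r y z → r x z) :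
    ∃ R, IsWeakOrder X R ∧ ∀ x, x ∈ X → ∀ y, y ∈ X → (LeR R x y ↔ r x y) := by
  -- The quantified `x` and `y` occupy positions `2` and `3`, after the element `c` and the dummy
  -- argument of `IsRCA.setOf_mem`; this explains the form of `hr`.
  have hZ : {c | ∃ x y, x ∈ X ∧ y ∈ X ∧ c = pr x y ∧ r x y} ∈ S := by
    refine hS.setOf_mem <| .ex_of_le (fun _ => b) (Poly.const b) ?_ <|
      .ex_of_le (fun _ => b) (Poly.const b) ?_ <| .and (.mem (Poly.var _) hX) <|
      .and (.mem (Poly.var _) hX) <| .and (.eq (Poly.var _) ((Poly.var _).pr (Poly.var _))) hr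
    · rintro v x ⟨y, hx, -⟩
      exact (hb x hx).le
    · rintro v y ⟨-, hy, -⟩
      exact (hb y hy).le
  obtain ⟨R, hR, hRZ⟩ := hS.exists_code hZ (k := pr b b + 1) (by
    rintro _ ⟨x, y, hx, hy, rfl, -⟩
    exact lt_add_one_iff_le.2 (pr_mono (hb x hx).le (hb y hy).le))
  have hle : ∀ x, x ∈ X → ∀ y, y ∈ X → (LeR R x y ↔ r x y) := by
    intro x hx y hy
    rw [LeR, hRZ]
    constructor
    · rintro ⟨x', y', -, -, h, hxy⟩
      obtain ⟨rfl, rfl⟩ := pr_inj.1 h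
      exact hxy
    · exact fun h => ⟨x, y, hx, hy, rfl, h⟩
  refine ⟨R, ⟨hR, fun c hc => ?_, fun x hx y hy => ?_, fun x hx y hy z hz => ?_⟩, hle⟩
  · obtain ⟨x, y, hx, hy, h, -⟩ := (hRZ c).1 hc
    exact ⟨x, hx, y, hy, h⟩
  · rw [hle x hx y hy, hle y hy x hx]
    exact htotal x hx y hy
  · rw [hle x hx y hy, hle y hy z hz, hle x hx z hz]
    exact fun h => htrans x hx y hy z hz h.1 h.2

/-- There is a weak order in which `x` is strictly below everything else. -/
theorem exists_isWeakOrder_bottom (hS : IsRCA S) (hX : X ∈ S) (hb : ∀ x, x ∈ X → x < b)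
    {x : N} (hx : x ∈ X) :
    ∃ R, IsWeakOrder X R ∧ ∀ y, y ∈ X → x ≠ y → LtR R x y := by
  -- Two indifference classes: `x` alone at the bottom and everything else tied above it.
  obtain ⟨R, hR, hle⟩ := exists_isWeakOrder hS hX hb (r := fun y z => y = x ∨ ¬ z = x)
    (.or (.eq (Poly.var _) (Poly.const x)) (.neg (.eq (Poly.var _) (Poly.const x))))
    (fun y _ z _ => by tauto) (fun y _ z _ w _ => by tauto)
  refine ⟨R, hR, fun y hy hxy => ⟨?_, ?_⟩⟩
  · exact (hle x hx y hy).2 (Or.inl rfl)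
  · rw [hle y hy x hx]
    rintro (h | h)
    · exact hxy h.symm
    · exact h rfl

theorem exists_code_insert (hS : IsRCA S) (s z : N) :
    ∃ t, IsFinSetCode t ∧ ∀ c, InCode c t ↔ InCode c s ∨ c = z := by
  have hZ : {c | InCode c s ∨ c = z} ∈ S :=
    hS.setOf_mem (.or (.inCode (Poly.var _) (Poly.const s)) (.eq (Poly.var _) (Poly.const z)))
  obtain ⟨t, ht, h⟩ := hS.exists_code hZ (k := s + z + 1) (by
    rintro c (hc | rfl)
    · exact lt_add_one_iff_le.2 (hc.lt.le.trans le_self_add)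
    · exact lt_add_one_iff_le.2 le_add_self)
  exact ⟨t, ht, h⟩

/-- Two numbers form a sequence of length two. -/
theorem exists_code_pair (hS : IsRCA S) (a a' : N) :
    ∃ s, IsFinSetCode s ∧ ∀ c, InCode c s ↔ c = pr 0 a ∨ c = pr 1 a' := by
  obtain ⟨s, -, hs⟩ := exists_code_insert hS 0 (pr (0 : N) a)
  obtain ⟨t, ht, h⟩ := exists_code_insert hS s (pr (1 : N) a')
  refine ⟨t, ht, fun c => ?_⟩
  rw [h, hs]
  have : ¬ InCode c 0 := fun h => not_lt_zero h.lt
  tauto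

theorem InCode.left_lt {i j s : N} (h : InCode (pr i j) s) : i < s :=
  (le_pr_left i j).trans_lt h.lt

theorem InCode.right_lt {i j s : N} (h : InCode (pr i j) s) : j < s :=
  (le_pr_right i j).trans_lt h.lt

/-- `s` enumerates, without repetitions, `R₀`, `R₁` and the elements of `W` less than `c`;
the length of the enumeration is `l`. -/
def Enumerates (W : Set N) (R₀ R₁ c l s : N) : Prop :=
  (∀ z, InCode z s → ∃ i, i < l ∧ ∃ R, z = pr i R ∧ R ∈ W ∧ (R < c ∨ R = R₀ ∨ R = R₁)) ∧
  (∀ i, i < l → ∃ R, InCode (pr i R) s) ∧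
  (∀ i R R', InCode (pr i R) s ∧ InCode (pr i R') s → R = R') ∧
  (∀ R i j, InCode (pr i R) s ∧ InCode (pr j R) s → i = j) ∧
  (∀ R, R < c → R ∈ W → ∃ i, i < l ∧ InCode (pr i R) s) ∧
  InCode (pr 0 R₀) s ∧ InCode (pr 1 R₁) s ∧ 1 < l

/-- All indices and entries are bounded by `s`. Position `1` is left for the number that packs `l`
and `s` in the induction. -/
theorem delta0_enumerates {W : Set N} (hW : W ∈ S) (R₀ R₁ : N) :
    Delta0 S fun w : Fin 4 → N => Enumerates W R₀ R₁ (w 0) (w 2) (w 3) := by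
  have hin : ∀ {n : ℕ} (i j k : Fin n), Delta0 S fun w => InCode (pr (w i) (w j)) (w k) :=
    fun i j k => .inCode ((Poly.var i).pr (Poly.var j)) (Poly.var k)
  refine .and ?_ <| .and ?_ <| .and ?_ <| .and ?_ <| .and ?_ <| .and ?_ <| .and ?_ ?_
  · refine .all_of_le (fun w => w 3) (Poly.var 3) ?_ <|
      .imp (.inCode (Poly.var _) (Poly.var _)) <| .bex (Poly.var _) <|
      .ex_of_le (fun w => w 4) (Poly.var 4) ?_ <|
      .and (.eq (Poly.var _) ((Poly.var _).pr (Poly.var _))) <| .and (.mem (Poly.var _) hW) <|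
      .or (.lt (Poly.var _) (Poly.var _)) <|
      .or (.eq (Poly.var _) (Poly.const _)) (.eq (Poly.var _) (Poly.const _))
    · intro w z hz
      exact (Classical.not_imp.1 hz).1.lt.le
    · rintro w R ⟨h, -⟩
      exact (le_pr_right _ _).trans h.ge
  · refine .ball (Poly.var _) <| .ex_of_le (fun w => w 3) (Poly.var 3) ?_ (hin _ _ _)
    exact fun w R h => h.right_lt.le
  · refine .all_of_le (fun w => w 3) (Poly.var 3) ?_ <| .all_of_le (fun w => w 3) (Poly.var 3) ?_ <|
      .all_of_le (fun w => w 3) (Poly.var 3) ?_ <| .imp (.and (hin _ _ _) (hin _ _ _))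
        (.eq (Poly.var _) (Poly.var _))
    · intro w i h
      push Not at h
      obtain ⟨R, R', h, -⟩ := h
      exact h.1.left_lt.le
    · intro w R h
      push Not at h
      obtain ⟨R', h, -⟩ := h
      exact h.1.right_lt.le
    · intro w R' h
      push Not at h
      exact h.1.2.right_lt.le
  · refine .all_of_le (fun w => w 3) (Poly.var 3) ?_ <| .all_of_le (fun w => w 3) (Poly.var 3) ?_ <|
      .all_of_le (fun w => w 3) (Poly.var 3) ?_ <| .imp (.and (hin _ _ _) (hin _ _ _))
        (.eq (Poly.var _) (Poly.var _))
    · intro w R h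
      push Not at h
      obtain ⟨i, j, h, -⟩ := h
      exact h.1.right_lt.le
    · intro w i h
      push Not at h
      obtain ⟨j, h, -⟩ := h
      exact h.1.left_lt.le
    · intro w j h
      push Not at h
      exact h.1.2.left_lt.le
  · exact .ball (Poly.var _) <| .imp (.mem (Poly.var _) hW) <| .bex (Poly.var _) (hin _ _ _)
  · exact .inCode ((Poly.const _).pr (Poly.const _)) (Poly.var _)
  · exact .inCode ((Poly.const _).pr (Poly.const _)) (Poly.var _)
  · exact .lt (Poly.const 1) (Poly.var _)

/-- `Σ⁰₁` induction on `c`, starting from the list `R₀, R₁`. The pair `(l, s)` is packed into one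
witness to fit the single existential quantifier. -/
theorem exists_enumerates (hS : IsRCA S) {W : Set N} (hW : W ∈ S) {R₀ R₁ : N} (h₀ : R₀ ∈ W)
    (h₁ : R₁ ∈ W) (hne : R₀ ≠ R₁) (c : N) : ∃ l s, Enumerates W R₀ R₁ c l s := by
  have main : ∀ c, ∃ u, ∃ l s, u = pr l s ∧ Enumerates W R₀ R₁ c l s := by
    refine hS.sigma_induction (fun c u => ∃ l s, u = pr l s ∧ Enumerates W R₀ R₁ c l s) ?_ ?_ ?_
    · refine .ex_of_le (fun w => w 1) (Poly.var 1) ?_ <| .ex_of_le (fun w => w 1) (Poly.var 1) ?_ <|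
        .and (.eq (Poly.var _) ((Poly.var _).pr (Poly.var _))) (delta0_enumerates hW R₀ R₁)
      · rintro w l ⟨s, h, -⟩
        exact (le_pr_left _ _).trans h.ge
      · rintro w s ⟨h, -⟩
        exact (le_pr_right _ _).trans h.ge
    · obtain ⟨s, -, hs⟩ := exists_code_pair hS R₀ R₁
      refine ⟨_, 1 + 1, s, rfl, ?_, ?_, ?_, ?_, ?_, ?_, ?_, ?_⟩
      · intro z hz
        rcases (hs z).1 hz with rfl | rfl
        · exact ⟨0, by positivity, R₀, rfl, h₀, by simp⟩
        · exact ⟨1, lt_add_one 1, R₁, rfl, h₁, by simp⟩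
      · intro i hi
        rcases eq_or_lt_of_le (lt_add_one_iff_le.1 hi) with rfl | hlt
        · exact ⟨R₁, (hs _).2 (Or.inr rfl)⟩
        · rw [← zero_add (1 : N), lt_add_one_iff_le] at hlt
          obtain rfl := le_antisymm hlt zero_le
          exact ⟨R₀, (hs _).2 (Or.inl rfl)⟩
      · rintro i R R' ⟨h, h'⟩
        rw [hs, pr_inj, pr_inj] at h h'
        rcases h with ⟨rfl, rfl⟩ | ⟨rfl, rfl⟩ <;> rcases h' with ⟨h, rfl⟩ | ⟨h, rfl⟩ <;>
          first | rfl | simp at h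
      · rintro R i j ⟨h, h'⟩
        rw [hs, pr_inj, pr_inj] at h h'
        rcases h with ⟨rfl, rfl⟩ | ⟨rfl, rfl⟩ <;> rcases h' with ⟨rfl, h⟩ | ⟨rfl, h⟩ <;>
          first | rfl | exact absurd h hne | exact absurd h.symm hne
      · exact fun R hR => absurd hR not_lt_zero
      · exact (hs _).2 (Or.inl rfl)
      · exact (hs _).2 (Or.inr rfl)
      · exact lt_add_one 1
    · rintro c ⟨_, l, s, rfl, hz, hdom, hfun, hinj, hsurj, hR₀, hR₁, hl⟩
      -- A new element `c` is appended at position `l`; otherwise the list stays, since `R₀` and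
      -- `R₁` have been in it from the start.
      by_cases hc : c ∈ W ∧ c ≠ R₀ ∧ c ≠ R₁
      · obtain ⟨t, -, ht⟩ := exists_code_insert hS s (pr l c)
        have hlt : ∀ {i R}, InCode (pr i R) s → i < l := by
          intro i R h
          obtain ⟨i', hi', R', h, -⟩ := hz _ h
          rwa [(pr_inj.1 h).1]
        have hnew : ∀ i, ¬ InCode (pr i c) s := by
          intro i h
          obtain ⟨i', -, R', h, -, h'⟩ := hz _ h
          rw [← (pr_inj.1 h).2] at h'
          rcases h' with h' | h' | h'
          · exact lt_irrefl _ h'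
          · exact hc.2.1 h'
          · exact hc.2.2 h'
        refine ⟨_, l + 1, t, rfl, ?_, ?_, ?_, ?_, ?_, ?_, ?_, ?_⟩
        · intro z hzt
          rcases (ht z).1 hzt with h | rfl
          · obtain ⟨i, hi, R, rfl, hR, h'⟩ := hz z h
            exact ⟨i, hi.trans (lt_add_one l), R, rfl, hR,
              h'.imp_left fun h => h.trans (lt_add_one c)⟩
          · exact ⟨l, lt_add_one l, c, rfl, hc.1, Or.inl (lt_add_one c)⟩
        · intro i hi
          rcases eq_or_lt_of_le (lt_add_one_iff_le.1 hi) with rfl | hlt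
          · exact ⟨c, (ht _).2 (Or.inr rfl)⟩
          · obtain ⟨R, hR⟩ := hdom i hlt
            exact ⟨R, (ht _).2 (Or.inl hR)⟩
        · rintro i R R' ⟨h, h'⟩
          rw [ht, pr_inj] at h h'
          rcases h with h | ⟨rfl, rfl⟩ <;> rcases h' with h' | ⟨h1, rfl⟩
          · exact hfun i R R' ⟨h, h'⟩
          · subst h1; exact absurd (hlt h) (lt_irrefl _)
          · exact absurd (hlt h') (lt_irrefl _)
          · rfl
        · rintro R i j ⟨h, h'⟩
          rw [ht, pr_inj] at h h'
          rcases h with h | ⟨rfl, rfl⟩ <;> rcases h' with h' | ⟨rfl, h1⟩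
          · exact hinj R i j ⟨h, h'⟩
          · subst h1; exact absurd h (hnew _)
          · exact absurd h' (hnew _)
          · rfl
        · intro R hR hRW
          rcases eq_or_lt_of_le (lt_add_one_iff_le.1 hR) with rfl | hlt
          · exact ⟨l, lt_add_one l, (ht _).2 (Or.inr rfl)⟩
          · obtain ⟨i, hi, h⟩ := hsurj R hlt hRW
            exact ⟨i, hi.trans (lt_add_one l), (ht _).2 (Or.inl h)⟩
        · exact (ht _).2 (Or.inl hR₀)
        · exact (ht _).2 (Or.inl hR₁)
        · exact hl.trans (lt_add_one l)
      · refine ⟨_, l, s, rfl, ?_, hdom, hfun, hinj, ?_, hR₀, hR₁, hl⟩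
        · intro z hzs
          obtain ⟨i, hi, R, rfl, hR, h'⟩ := hz z hzs
          exact ⟨i, hi, R, rfl, hR, h'.imp_left fun h => h.trans (lt_add_one c)⟩
        · intro R hR hRW
          rcases eq_or_lt_of_le (lt_add_one_iff_le.1 hR) with rfl | hlt
          · by_cases h0 : R = R₀
            · subst h0
              exact ⟨0, zero_lt_one.trans hl, hR₀⟩
            · by_cases h1 : R = R₁
              · subst h1
                exact ⟨1, hl, hR₁⟩
              · exact absurd ⟨hRW, h0, h1⟩ hc
          · exact hsurj R hlt hRW
  obtain ⟨_, l, s, -, h⟩ := main c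
  exact ⟨l, s, h⟩

/-- There is a permutation of the set of weak orders beginning with two given ones. -/
theorem exists_isPerm (hS : IsRCA S) (hX : X ∈ S) (hb : ∀ x, x ∈ X → x < b) {R₀ R₁ : N}
    (h₀ : IsWeakOrder X R₀) (h₁ : IsWeakOrder X R₁) (hne : R₀ ≠ R₁) :
    ∃ p l, IsPerm X p l ∧ 1 < l ∧ Entry p 0 R₀ ∧ Entry p 1 R₁ := by
  obtain ⟨B, hB⟩ := exists_isWeakOrder_bound hS hb
  obtain ⟨l, s, hz, hdom, hfun, hinj, hsurj, hR₀, hR₁, hl⟩ :=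
    exists_enumerates hS (setOf_isWeakOrder_mem hS hX hb) h₀ h₁ hne B
  -- `Enumerates` does not ask that `s` be a least code, while a sequence must be one; so the same
  -- finite set is coded again.
  obtain ⟨p, hp, hps⟩ := hS.exists_code (setOf_inCode_mem hS s) (k := s) fun i hi => hi.lt
  simp only [Set.mem_ofPred_eq] at hps
  refine ⟨p, l, ⟨⟨hp, fun c hc => ?_, fun i hi => ?_⟩, fun i R hR => ?_, fun R hR => ?_⟩, hl,
    (hps _).2 hR₀, (hps _).2 hR₁⟩
  · obtain ⟨i, hi, R, h, -⟩ := hz c ((hps c).1 hc)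
    exact ⟨i, R, h, hi, rfl⟩
  · obtain ⟨R, hR⟩ := hdom i hi
    exact ⟨R, (hps _).2 hR, fun R' hR' => hfun i R' R ⟨(hps _).1 hR', hR⟩⟩
  · obtain ⟨i', -, R', h, hRW, -⟩ := hz _ ((hps _).1 hR)
    rw [(pr_inj.1 h).2]
    exact hRW
  · obtain ⟨i, -, hi⟩ := hsurj R (hB R hR) hR
    exact ⟨i, (hps _).2 hi, fun j hj => hinj R j i ⟨(hps _).1 hj, hi⟩⟩

end WeakOrders

/-! ### Profiles, measurability, and the construction of `σ` -/

section Profiles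

variable {N : Type u} [DiscreteSemiring N] {S : Set (Set N)} {V X A F U : Set N}

theorem IsProfileSeq.exists_order (hF : IsProfileSeq V X F) (i : N) {v : N} (hv : v ∈ V) :
    ∃ R, IsWeakOrder X R ∧ pr i (pr v R) ∈ F ∧ ∀ R', pr i (pr v R') ∈ F → R' = R := by
  obtain ⟨R, hR, huniq⟩ := (hF i).2 v hv
  obtain ⟨v', R', h, -, hR'⟩ := (hF i).1 _ hR
  rw [← (pr_inj.1 h).2] at hR'
  exact ⟨R, hR', hR, huniq⟩

theorem IsProfileSeq.leP_iff {i v R : N} (hF : IsProfileSeq V X F) (hv : v ∈ V)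
    (hR : pr i (pr v R) ∈ F) (x y : N) : LeP F i v x y ↔ LeR R x y := by
  obtain ⟨R₀, -, -, huniq⟩ := hF.exists_order i hv
  refine ⟨fun ⟨R', hR', h⟩ => ?_, fun h => ⟨R, hR, h⟩⟩
  rwa [huniq R hR, ← huniq R' hR']

theorem IsProfileSeq.ltP_iff (hF : IsProfileSeq V X F) (i : N) {v : N} (hv : v ∈ V) (x y : N) :
    LtP F i v x y ↔ LeP F i v x y ∧ ¬ LeP F i v y x := by
  obtain ⟨R, -, hR, huniq⟩ := hF.exists_order i hv
  rw [hF.leP_iff hv hR, hF.leP_iff hv hR]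
  refine ⟨fun ⟨R', hR', h⟩ => ?_, fun h => ⟨R, hR, h⟩⟩
  rwa [← huniq R' hR']

theorem IsProfileSeq.leP_total (hF : IsProfileSeq V X F) (i : N) {v x y : N} (hv : v ∈ V)
    (hx : x ∈ X) (hy : y ∈ X) : LeP F i v x y ∨ LeP F i v y x := by
  obtain ⟨R, hRW, hR, -⟩ := hF.exists_order i hv
  rw [hF.leP_iff hv hR, hF.leP_iff hv hR]
  exact hRW.2.2.1 x hx y hy

theorem IsProfileSeq.leP_trans (hF : IsProfileSeq V X F) (i : N) {v x y z : N} (hv : v ∈ V)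
    (hx : x ∈ X) (hy : y ∈ X) (hz : z ∈ X) (h : LeP F i v x y) (h' : LeP F i v y z) :
    LeP F i v x z := by
  obtain ⟨R, hRW, hR, -⟩ := hF.exists_order i hv
  rw [hF.leP_iff hv hR] at h h' ⊢
  exact hRW.2.2.2 x hx y hy z hz ⟨h, h'⟩

/-- For every coalition there is a profile in which its members prefer `y` to `x` and all others
prefer `x` to `y`. -/
theorem exists_opposed_profile (hS : IsRCA S) (hX : X ∈ S) {b : N} (hb : ∀ x, x ∈ X → x < b)
    (hF : IsProfileSeq V X F) (hQ : IsQPEmbedded S V X A F) (k : N) {x y : N} (hx : x ∈ X)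
    (hy : y ∈ X) (hxy : x ≠ y) :
    ∃ n, ∀ v, v ∈ V → (pr k v ∈ A → LtP F n v x y) ∧ (¬ pr k v ∈ A → LtP F n v y x) := by
  obtain ⟨R₀, hW₀, h₀⟩ := exists_isWeakOrder_bottom hS hX hb hx
  obtain ⟨R₁, hW₁, h₁⟩ := exists_isWeakOrder_bottom hS hX hb hy
  have hlt₀ : LtR R₀ x y := h₀ y hy hxy
  have hlt₁ : LtR R₁ y x := h₁ x hx hxy.symm
  have hne : R₀ ≠ R₁ := by
    rintro rfl
    exact hlt₀.2 hlt₁.1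
  obtain ⟨p, l, hp, hl, hp₀, hp₁⟩ := exists_isPerm hS hX hb hW₀ hW₁ hne
  -- The embedding looks only at entries with index below `lh s - 1 = 0 + 1`; the second `k` is a
  -- filler giving length two, so that the default value is `p(1) = R₁`.
  obtain ⟨s, hs, hsc⟩ := exists_code_pair hS k k
  have hlt_two : ∀ {i : N}, i < 1 + 1 → i = 0 ∨ i = 1 := by
    intro i hi
    rcases eq_or_lt_of_le (lt_add_one_iff_le.1 hi) with rfl | hlt
    · exact Or.inr rfl
    · rw [← zero_add (1 : N), lt_add_one_iff_le] at hlt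
      exact Or.inl (le_antisymm hlt zero_le)
  have hentry : ∀ {i a : N}, Entry s i a → a = k := by
    intro i a h
    rcases (hsc _).1 h with h | h
    · exact (pr_inj.1 h).2
    · exact (pr_inj.1 h).2
  have hseq : IsSeq s (1 + 1) := by
    refine ⟨hs, fun c hc => ?_, fun i hi => ⟨k, ?_, fun a ha => hentry ha⟩⟩
    · rcases (hsc c).1 hc with rfl | rfl
      · exact ⟨0, k, rfl, by positivity, rfl⟩
      · exact ⟨1, k, rfl, lt_add_one 1, rfl⟩
    · rcases hlt_two hi with rfl | rfl
      · exact (hsc _).2 (Or.inl rfl)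
      · exact (hsc _).2 (Or.inr rfl)
  have hq : IsQPart l s (1 + 1) := ⟨hseq, le_add_self, add_one_le_of_lt hl⟩
  obtain ⟨e, ⟨-, he⟩, hprofile⟩ := hQ
  obtain ⟨n, hn, -⟩ := he (pr p s) ⟨p, s, l, 1 + 1, hp, hq, rfl⟩
  -- Only index `0` can be hit, so a unique hit exists exactly when `v ∈ A_k`.
  have hhit : ∀ {v i : N}, Hit A s (1 + 1) v i → i = 0 ∧ pr k v ∈ A := by
    rintro v i ⟨hi, a, ha, hav⟩
    rw [hentry ha] at hav
    have h1 : i < 0 + 1 := by rw [zero_add]; exact lt_of_add_lt_add_right hi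
    exact ⟨le_antisymm (lt_add_one_iff_le.1 h1) zero_le, hav⟩
  refine ⟨n, fun v hv => ?_⟩
  obtain ⟨R, -, hR, -⟩ := hF.exists_order n hv
  obtain ⟨hin, hout⟩ := hprofile p s l (1 + 1) n ⟨hp, hq, hn⟩ v hv R hR
  constructor
  · intro hvk
    have h0 : Hit A s (1 + 1) v 0 :=
      ⟨by rw [zero_add]; exact lt_add_one 1, k, (hsc _).2 (Or.inl rfl), hvk⟩
    have hR0 : Entry p 0 R := hin 0 ⟨h0, fun j hj => (hhit hj).1⟩
    obtain ⟨R', -, huniq⟩ := hp.1.2.2 0 (zero_lt_one.trans hl)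
    refine ⟨R, hR, ?_⟩
    rwa [huniq R hR0, ← huniq R₀ hp₀]
  · intro hvk
    obtain ⟨j, hj, hRj⟩ := hout (by
      rintro ⟨i, hi, -⟩
      exact hvk (hhit hi).2)
    rw [add_right_cancel hj] at hRj
    obtain ⟨R', -, huniq⟩ := hp.1.2.2 1 hl
    refine ⟨R, hR, ?_⟩
    rwa [huniq R hRj, ← huniq R₁ hp₁]

/-- Uniform measurability, with the set of all `(n, x, y)` whose coalition belongs to `U`. -/
theorem exists_measure (hS : IsRCA S) (hX : X ∈ S) (hU : U ∈ S) {b : N}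
    (hb : ∀ x, x ∈ X → x < b) (hM : IsUniformlyMeasurable S V X A F) :
    ∃ T ∈ S, ∀ n x, x ∈ X → ∀ y, y ∈ X → ∃ k,
      (∀ v, v ∈ V → (LeP F n v x y ↔ pr k v ∈ A)) ∧ (pr (pr n x) y ∈ T ↔ k ∈ U) := by
  obtain ⟨⟨μ, hμ⟩, ⟨hgraph, huniq⟩, hmeas⟩ := hM
  dsimp only at hgraph huniq hmeas
  have hT : {t | ∃ k, pr t k ∈ μ ∧ k ∈ U} ∈ S := by
    -- Because `μ` is single-valued, "some value is in `U`" equals "every value is in `U`" on its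
    -- domain. The `Π⁰₁` form must state that `t` is in the domain, as it would otherwise hold
    -- vacuously outside.
    refine hS.comprehension _ (fun t k => (∃ n x, x ∈ X ∧ ∃ y, y ∈ X ∧ t = pr (pr n x) y) ∧
      (pr t k ∈ μ → k ∈ U)) ?_ ?_ fun t => ⟨?_, ?_⟩
    · exact .and (.mem ((Poly.var _).pr (Poly.var _)) hμ) (.mem (Poly.var _) hU)
    · refine .and ?_ (.imp (.mem ((Poly.var _).pr (Poly.var _)) hμ) (.mem (Poly.var _) hU))
      refine .ex_of_le (fun v => v 0) (Poly.var 0) ?_ <|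
        .ex_of_le (fun _ => b) (Poly.const b) ?_ <| .and (.mem (Poly.var _) hX) <|
        .ex_of_le (fun _ => b) (Poly.const b) ?_ <| .and (.mem (Poly.var _) hX) <|
        .eq (Poly.var _) (((Poly.var _).pr (Poly.var _)).pr (Poly.var _))
      · rintro v n ⟨x, -, y, -, h⟩
        exact ((le_pr_left _ _).trans (le_pr_left _ _)).trans h.ge
      · rintro v x ⟨hx, -⟩
        exact (hb x hx).le
      · rintro v y ⟨hy, -⟩
        exact (hb y hy).le
    · rintro ⟨k, hk, hkU⟩ k'
      obtain ⟨t', _, h, hdom, -⟩ := hgraph _ hk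
      rw [← (pr_inj.1 h).1] at hdom
      refine ⟨hdom, fun hk' => ?_⟩
      obtain ⟨_, -, hz⟩ := huniq t hdom
      rwa [hz k' hk', ← hz k hk]
    · intro h
      obtain ⟨k, hk, -⟩ := huniq t (h 0).1
      exact ⟨k, hk, (h k).2 hk⟩
  refine ⟨_, hT, fun n x hx y hy => ?_⟩
  obtain ⟨k, hk, hk'⟩ := huniq (pr (pr n x) y) ⟨n, x, hx, y, hy, rfl⟩
  refine ⟨k, fun v hv => ?_, ⟨?_, fun h => ⟨k, hk, h⟩⟩⟩
  · rw [hmeas n x hx y hy v hv]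
    refine ⟨fun ⟨k₁, h, h'⟩ => ?_, fun h => ⟨k, hk, h⟩⟩
    rwa [← hk' k₁ h]
  · rintro ⟨k₁, h, h'⟩
    rwa [← hk' k₁ h]

/-- The social welfare function given by a definable choice of weak orders. -/
theorem exists_welfare_function (hS : IsRCA S) (hX : X ∈ S) {b : N} (hb : ∀ x, x ∈ X → x < b)
    {T : Set N} (hT : T ∈ S)
    (htotal : ∀ i x, x ∈ X → ∀ y, y ∈ X → pr (pr i x) y ∈ T ∨ pr (pr i y) x ∈ T)
    (htrans : ∀ i x, x ∈ X → ∀ y, y ∈ X → ∀ z, z ∈ X →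
      pr (pr i x) y ∈ T → pr (pr i y) z ∈ T → pr (pr i x) z ∈ T) :
    ∃ σ ∈ S, IsFunction (fun c => c ∈ σ) (fun _ => (0 : N) = 0) (IsWeakOrder X) ∧
      ∀ i R, pr i R ∈ σ → ∀ x, x ∈ X → ∀ y, y ∈ X → (LeR R x y ↔ pr (pr i x) y ∈ T) := by
  have hW := setOf_isWeakOrder_mem hS hX hb
  -- Quantifiers over `X` are bounded by `b`, and `W` is itself a set of `S`, so `σ` has a bounded
  -- definition.
  have hσ : {c | ∃ i R, c = pr i R ∧ R ∈ {R | IsWeakOrder X R} ∧ ∀ x, x < b → ∀ y, y < b →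
      (x ∈ X ∧ y ∈ X) → (InCode (pr x y) R ↔ pr (pr i x) y ∈ T)} ∈ S := by
    refine hS.setOf_mem <| .ex_of_le (fun v => v 0) (Poly.var 0) ?_ <|
      .ex_of_le (fun v => v 0) (Poly.var 0) ?_ <|
      .and (.eq (Poly.var _) ((Poly.var _).pr (Poly.var _))) <| .and (.mem (Poly.var _) hW) <|
      .ball (Poly.const b) <| .ball (Poly.const b) <|
      .imp (.and (.mem (Poly.var _) hX) (.mem (Poly.var _) hX)) <|
      .iff (.inCode ((Poly.var _).pr (Poly.var _)) (Poly.var _))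
        (.mem (((Poly.var _).pr (Poly.var _)).pr (Poly.var _)) hT)
    · rintro v i ⟨R, h, -⟩
      exact (le_pr_left _ _).trans h.ge
    · rintro v R ⟨h, -⟩
      exact (le_pr_right _ _).trans h.ge
  have key : ∀ i R, pr i R ∈ {c | ∃ i R, c = pr i R ∧ R ∈ {R | IsWeakOrder X R} ∧
      ∀ x, x < b → ∀ y, y < b → (x ∈ X ∧ y ∈ X) → (InCode (pr x y) R ↔ pr (pr i x) y ∈ T)} →
      IsWeakOrder X R ∧ ∀ x, x ∈ X → ∀ y, y ∈ X → (LeR R x y ↔ pr (pr i x) y ∈ T) := by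
    rintro i R ⟨i', R', h, hRW, hle⟩
    obtain ⟨rfl, rfl⟩ := pr_inj.1 h
    exact ⟨hRW, fun x hx y hy => hle x (hb x hx) y (hb y hy) ⟨hx, hy⟩⟩
  refine ⟨_, hσ, ⟨?_, fun i _ => ?_⟩, fun i R h => (key i R h).2⟩
  · rintro _ ⟨i, R, rfl, hRW, -⟩
    exact ⟨i, R, rfl, rfl, hRW⟩
  -- The slice of `T` at `i` is a weak order, hence has a code; uniqueness of codes makes `σ`
  -- single-valued.
  · obtain ⟨R, hRW, hR⟩ := exists_isWeakOrder hS hX hb (r := fun x y => pr (pr i x) y ∈ T)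
      (.mem (((Poly.const i).pr (Poly.var _)).pr (Poly.var _)) hT) (htotal i) (htrans i)
    refine ⟨R, ⟨i, R, rfl, hRW, fun x _ y _ h => hR x h.1 y h.2⟩, fun R' hR' => ?_⟩
    obtain ⟨hRW', hle⟩ := key i R' hR'
    exact hRW'.ext hRW fun x hx y hy => (hle x hx y hy).trans (hR x hx y hy).symm

end Profiles

/-! ### The social welfare function of an ultrafilter -/

section Main

variable {N : Type u} [DiscreteSemiring N] {S : Set (Set N)} {V X A F U : Set N}

theorem exists_swf_of_isUltrafilter (hS : IsRCA S) (hXS : X ∈ S) (hAS : A ∈ S) (hUS : U ∈ S)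
    (hsoc : IsSociety S V X A F) (hU : IsUltrafilter V A U) :
    ∃ σ : S, IsSWF V X F σ ∧ (∀ i, i ∈ U ↔ IsDecisive X A F σ i) ∧
      (¬ IsPrincipal A U ↔ HasCofiniteCoalitions V X F σ) := by
  obtain ⟨-, ⟨b, hb⟩, ⟨x₀, hx₀, y₀, hy₀, -, -, hxy₀, -, -⟩, hA, hat, hF, hM, hQ⟩ := hsoc
  obtain ⟨T, hTS, hT⟩ := exists_measure hS hXS hUS hb hM
  have hVU : ∃ i, i ∈ U := by
    obtain ⟨i, hi⟩ := hA.2.1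
    exact ⟨i, hU.1 i hi⟩
  obtain ⟨σ, hσS, hσ, hσT⟩ := exists_welfare_function hS hXS hb hTS (by
    intro i x hx y hy
    obtain ⟨k, hk, hkT⟩ := hT i x hx y hy
    obtain ⟨l, hl, hlT⟩ := hT i y hy x hx
    rw [hkT, hlT]
    refine hU.mem_or_mem hA fun v hv => ?_
    rw [← hk v hv, ← hl v hv]
    exact hF.leP_total i hv hx hy) (by
    intro i x hx y hy z hz
    obtain ⟨k, hk, hkT⟩ := hT i x hx y hy
    obtain ⟨l, hl, hlT⟩ := hT i y hy z hz
    obtain ⟨m, hm, hmT⟩ := hT i x hx z hz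
    rw [hkT, hlT, hmT]
    refine fun h h' => hU.mem_of_inter_subset hA h h' fun v hkv hlv => ?_
    have hv : v ∈ V := hA.1 _ _ hkv
    rw [← hk v hv] at hkv
    rw [← hl v hv] at hlv
    rw [← hm v hv]
    exact hF.leP_trans i hv hx hy hz hkv hlv)
  have hleS : ∀ i x, x ∈ X → ∀ y, y ∈ X → (LeS σ i x y ↔ pr (pr i x) y ∈ T) := by
    intro i x hx y hy
    constructor
    · rintro ⟨R, hR, h⟩
      exact (hσT i R hR x hx y hy).1 h
    · obtain ⟨R, hR, -⟩ := hσ.2 i rfl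
      exact fun h => ⟨R, hR, (hσT i R hR x hx y hy).2 h⟩
  have hltS : ∀ i x, x ∈ X → ∀ y, y ∈ X →
      (LtS σ i x y ↔ pr (pr i x) y ∈ T ∧ ¬ pr (pr i y) x ∈ T) := by
    intro i x hx y hy
    constructor
    · rintro ⟨R, hR, h⟩
      rwa [LtR, hσT i R hR x hx y hy, hσT i R hR y hy x hx] at h
    · obtain ⟨R, hR, -⟩ := hσ.2 i rfl
      intro h
      refine ⟨R, hR, ?_⟩
      rwa [LtR, hσT i R hR x hx y hy, hσT i R hR y hy x hx]
  have hdec : ∀ i, i ∈ U → IsDecisive X A F σ i := by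
    intro i hi x hx y hy j hlt
    rw [hltS j x hx y hy]
    obtain ⟨k, hk, hkT⟩ := hT j x hx y hy
    obtain ⟨l, hl, hlT⟩ := hT j y hy x hx
    rw [hkT, hlT]
    constructor
    -- Strictness has two halves: the coalition for `x ≲ y` contains `A_i`, so it is in `U`; the one
    -- for `y ≲ x` is disjoint from `A_i`, so it is not.
    · refine hU.2.2.1 i k ⟨hi, fun v hv => ?_⟩
      have hvV := hA.1 _ _ hv
      exact (hk v hvV).1 ((hF.ltP_iff j hvV x y).1 (hlt v hv)).1
    · intro hlU
      obtain ⟨v, hvV, hv, hvl⟩ := hU.exists_mem_inter hA hi hlU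
      exact ((hF.ltP_iff j hvV x y).1 (hlt v hv)).2 ((hl v hvV).2 hvl)
  have hasymm : ∀ {j x y}, x ∈ X → y ∈ X → LtS σ j x y → LtS σ j y x → False := by
    intro j x y hx hy h h'
    rw [hltS j x hx y hy] at h
    rw [hltS j y hy x hx] at h'
    exact h.2 h'.1
  refine ⟨⟨σ, hσS⟩, ⟨hσ, ?_, ?_⟩, fun i => ⟨hdec i, fun hi => ?_⟩, ⟨fun hnp => ?_, ?_⟩⟩
  · intro x hx y hy i hlt
    obtain ⟨k, hk⟩ := hVU
    exact hdec k hk x hx y hy i fun v hv => hlt v (hA.1 _ _ hv)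
  · intro x hx y hy i j hagree a c hac
    have ha : a ∈ X := by rcases hac.1 with rfl | rfl <;> assumption
    have hc : c ∈ X := by rcases hac.2 with rfl | rfl <;> assumption
    change LeS σ i a c ↔ LeS σ j a c
    rw [hleS i a ha c hc, hleS j a ha c hc]
    obtain ⟨k, hk, hkT⟩ := hT i a ha c hc
    obtain ⟨l, hl, hlT⟩ := hT j a ha c hc
    rw [hkT, hlT]
    -- The indices `k` and `l` may differ, but they name the same coalition, and membership in `U`
    -- respects this.
    have hkl : ∀ v, pr k v ∈ A ↔ pr l v ∈ A := by
      intro v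
      by_cases hv : v ∈ V
      · rw [← hk v hv, ← hl v hv]
        exact hagree v hv a c hac
      · exact iff_of_false (fun h => hv (hA.1 _ _ h)) fun h => hv (hA.1 _ _ h)
    exact ⟨fun h => hU.2.2.1 k l ⟨h, fun v => (hkl v).1⟩,
      fun h => hU.2.2.1 l k ⟨h, fun v => (hkl v).2⟩⟩
  · obtain ⟨j, hj, hiU | hjU⟩ := exists_compl_index hA hU i
    · exact hiU
    -- Both `A_i` and its complement would be decisive, and on this profile they force opposite
    -- strict social preferences.
    · obtain ⟨n, hn⟩ := exists_opposed_profile hS hXS hb hF hQ i hx₀ hy₀ hxy₀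
      have h1 : LtS σ n x₀ y₀ :=
        hi x₀ hx₀ y₀ hy₀ n fun v hv => (hn v (hA.1 _ _ hv)).1 hv
      have h2 : LtS σ n y₀ x₀ := hdec j hjU y₀ hy₀ x₀ hx₀ n fun v hv =>
        (hn v ((hj v).1 hv).1).2 ((hj v).1 hv).2
      exact (hasymm hx₀ hy₀ h1 h2).elim
  · rintro j x hx y hy ⟨k, hk⟩
    obtain ⟨m, hmU, hm⟩ := hU.exists_mem_avoiding hS hAS hUS hA hat hVU hnp k
    exact hdec m hmU x hx y hy j fun v hv =>
      hk v (hA.1 _ _ hv) (not_lt.1 fun hlt => hm v hlt hv)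
  · rintro hcof ⟨k, d, hkU, hkd⟩
    -- The dictator `d` opposes all other voters. Decisiveness of `{d}` contradicts the cofinite
    -- coalition of voters from `d + 1` on.
    obtain ⟨n, hn⟩ := exists_opposed_profile hS hXS hb hF hQ k hx₀ hy₀ hxy₀
    have h1 : LtS σ n x₀ y₀ :=
      hdec k hkU x₀ hx₀ y₀ hy₀ n fun v hv => (hn v (hA.1 _ _ hv)).1 hv
    have h2 : LtS σ n y₀ x₀ := hcof n y₀ hy₀ x₀ hx₀ ⟨d + 1, fun v hv hdv => (hn v hv).2 fun h => by
      rw [(hkd v).1 h] at hdv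
      exact absurd (lt_of_lt_of_le (lt_add_one d) hdv) (lt_irrefl _)⟩
    exact hasymm hx₀ hy₀ h1 h2

end Main

end L2

theorem lemma5p3 : L2.IsTheoremOf.{u} L2.RCA₀ L2.converseKS := by
  intro M hM
  have : L2.ModelsRCA M := ⟨hM⟩
  refine M.satisfies_converseKS fun V X A F U h => ?_
  exact L2.exists_swf_of_isUltrafilter M.isRCA X.2 A.2 U.2 h.1 h.2
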